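/- **Setting.** Fix real parameters $\mu,\lambda\in\mathbb{R}$ and $\gamma,\vartheta,\beta>0$. Let $\mathfrak{C}:=[-1/2,1/2]^3$, $\Lambda_l:=\{-l,\dots,l-1\}^3\subset\mathbb{Z}^3$ for $l\in\mathbb{N}$, and let $\mathcal{U}_{\Lambda_l}$ be the algebra of all linear operators on the fermion Fock space over $\bigoplus_{x\in\Lambda_l}\mathbb{C}^2$, with annihilation operators $a_{x,\mathrm{s}}$ ($x\in\Lambda_l$, $\mathrm{s}\in\{\uparrow,\downarrow\}$) and $n_{x,\mathrm{s}}:=a_{x,\mathrm{s}}^*a_{x,\mathrm{s}}$. For $\mathrm{B}=(\mathrm{b}_1,\mathrm{b}_2,\mathrm{b}_3)\in L^2(\mathfrak{C};\mathbb{R}^3)$, extended by zero outside $\mathfrak{C}$, put $\bar{\mathrm{b}}_i(x):=\int_{\mathfrak{C}}\mathrm{b}_i\big(\tfrac{x+y}{2l}\big)\,\mathrm{d}^3y$ and $$H_l:=-\mu\sum_{x\in\Lambda_l}(n_{x,\uparrow}+n_{x,\downarrow})+2\lambda\sum_{x\in\Lambda_l}n_{x,\uparrow}n_{x,\downarrow}-\frac{\gamma}{|\Lambda_l|}\sum_{x,y\in\Lambda_l}a_{x,\uparrow}^*a_{x,\downarrow}^*a_{y,\downarrow}a_{y,\uparrow}$$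 $$-\vartheta\sum_{x\in\Lambda_l}\Big\{\bar{\mathrm{b}}_1(x)\big(a_{x,\uparrow}^*a_{x,\downarrow}+a_{x,\downarrow}^*a_{x,\uparrow}\big)-i\,\bar{\mathrm{b}}_2(x)\big(a_{x,\uparrow}^*a_{x,\downarrow}-a_{x,\downarrow}^*a_{x,\uparrow}\big)+\bar{\mathrm{b}}_3(x)\big(n_{x,\uparrow}-n_{x,\downarrow}\big)\Big\}.$$ Let $E_{\Lambda_l}$ be the set of states (positive normalized linear functionals) on $\mathcal{U}_{\Lambda_l}$. For $\rho\in E_{\Lambda_l}$ with density matrix $\mathrm{d}_\rho$, the free-energy density is $$f_l(\mathrm{B},\rho):=|\Lambda_l|^{-1}\big\{\rho(H_l)-\beta^{-1}S_l(\rho)\big\},\qquad S_l(\rho):=-\mathrm{Trace}(\mathrm{d}_\rho\log\mathrm{d}_\rho),$$ with $0\log 0:=0$. Let $\xi\in C_0^\infty(\mathbb{R}^3;\mathbb{R})$ be spherically symmetric and non-negative with $\xi(0)>0$, $\int_{\mathbb{R}^3}\xi(\mathfrak{t})\,\mathrm{d}^3\mathfrak{t}=1$ and $\int_{\mathbb{R}^2}\xi(0,\mathfrak{t}_2,\mathfrak{t}_3)\,\mathrm{d}\mathfrak{t}_2\mathrm{d}\mathfrak{t}_3=1$.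 With the current observables $$\mathrm{I}_l^{x,y}:=\frac{4\gamma}{|\Lambda_l|}\,\mathrm{Im}\big(a_{x,\uparrow}^*a_{x,\downarrow}^*a_{y,\downarrow}a_{y,\uparrow}\big),\qquad \mathrm{Im}(A):=\frac{A-A^*}{2i},$$ the current density and the rescaled current density of $\rho\in E_{\Lambda_l}$ are, for $x,\mathfrak{t}\in\mathbb{R}^3$, $$j_\rho(x):=\sum_{y,z\in\Lambda_l,\ y\neq z}\frac{z-y}{|z-y|^3}\,\xi\Big(\frac{x-\frac{y+z}{2}}{|z-y|}\Big)\,\rho\big(\mathrm{I}_l^{y,z}\big),\qquad j_\rho^{(l)}(\mathfrak{t}):=2l\,j_\rho(2l\,\mathfrak{t}).$$ **Theorem (Thermodynamic stability of currents).** For every $\mathrm{B}\in L^2(\mathfrak{C};\mathbb{R}^3)$ and every current density $\mathrm{j}\in C^\infty(\mathfrak{C};\mathbb{R}^3)$ that vanishes on the boundary $\partial\mathfrak{C}$ and is extended by zero to $\mathbb{R}^3$, the functional $f_l(\mathrm{B},\cdot)$ is bounded below on $E_{\Lambda_l}$ for every $l\in\mathbb{N}$, and there are states $\rho_l\in E_{\Lambda_l}$,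 $l\in\mathbb{N}$, such that $$\lim_{l\to\infty}\Big|f_l(\mathrm{B},\rho_l)-\inf_{\rho\in E_{\Lambda_l}}f_l(\mathrm{B},\rho)\Big|=0\qquad\text{and}\qquad\lim_{l\to\infty}\ \sup_{\mathfrak{t}\in\mathbb{R}^3}\big|j_{\rho_l}^{(l)}(\mathfrak{t})-\mathrm{j}(\mathfrak{t})\big|=0.$$ -/

import Mathlib

open MeasureTheory Filter Topology
open scoped ContDiff ComplexOrder Matrix

noncomputable section

namespace BCSHubbard

/-- Euclidean space `ℝ³` with the norm `|x| = √(x₁² + x₂² + x₃²)`. -/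
abbrev Space : Type := EuclideanSpace ℝ (Fin 3)

/-- The closed unit cube `[-1/2, 1/2]³`. -/
def cube : Set Space := {t | ∀ i, t i ∈ Set.Icc (-(1 / 2) : ℝ) (1 / 2)}

/-- Sites of the cubic crystal `ℤ³`. -/
abbrev Site : Type := Fin 3 → ℤ

/-- The inclusion `ℤ³ ⊆ ℝ³`. -/
def Site.toSpace (x : Site) : Space := WithLp.toLp 2 fun i => (x i : ℝ)

/-- The box `{-l, …, l - 1}³` of side length `2 l`. -/
def box (l : ℕ) : Finset Site := Fintype.piFinset fun _ => Finset.Ico (-(l : ℤ)) (l : ℤ)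

/-! ### Fermions in a box -/

/-- Spins: `0` is `↑`, `1` is `↓`. -/
abbrev Spin : Type := Fin 2

/-- Spin `↑`. -/
abbrev up : Spin := 0

/-- Spin `↓`. -/
abbrev dn : Spin := 1

/-- One-particle modes `(x, s)` of the box: they label the orthonormal basis of the one-particle
Hilbert space, the direct sum over the sites `x` of the box of copies of `ℂ²`. -/
def Mode (l : ℕ) : Type := box l × Spin

instance (l : ℕ) : Fintype (Mode l) := inferInstanceAs (Fintype (box l × Spin))

/-- Lexicographic order of the modes. It only fixes the signs of the basis vectors of
the Fock space. -/
instance (l : ℕ) : LinearOrder (Mode l) :=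
  LinearOrder.lift' (fun m : Mode l => toLex (toLex (m.1 : Site), m.2)) (by
    rintro ⟨⟨x, hx⟩, s⟩ ⟨⟨y, hy⟩, t⟩ h
    have h' := congrArg ofLex h
    simp only [ofLex_toLex, Prod.mk.injEq] at h'
    obtain ⟨h1, h2⟩ := h'
    have h3 : x = y := congrArg ofLex h1
    subst h3
    subst h2
    rfl)

/-- All linear operators on the fermion Fock space over the box, written as matrices in the
occupation number orthonormal basis `e_S = e_{m₁} ∧ ⋯ ∧ e_{mₖ}`, where `S = {m₁ < ⋯ < mₖ}` runs
over the finite sets of modes. The adjoint is the conjugate transpose `ᴴ`. -/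
abbrev Algebra (l : ℕ) : Type := Matrix (Finset (Mode l)) (Finset (Mode l)) ℂ

/-- Annihilation operator of a mode:
`a_m e_S = (-1) ^ #{m' ∈ S | m' < m} e_{S \ {m}}` if `m ∈ S`, and `a_m e_S = 0` otherwise. -/
def annihilate {l : ℕ} (m : Mode l) : Algebra l := fun T S =>
  if m ∈ S ∧ T = S.erase m then (-1) ^ (S.filter (· < m)).card else 0

/-- `a_{x,s}`. -/
def a {l : ℕ} (x : box l) (s : Spin) : Algebra l := annihilate (show Mode l from (x, s))

/-- `a*_{x,s}`. -/
def aStar {l : ℕ} (x : box l) (s : Spin) : Algebra l := (a x s)ᴴ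

/-- The particle number operator `n_{x,s} = a*_{x,s} a_{x,s}`. -/
def num {l : ℕ} (x : box l) (s : Spin) : Algebra l := aStar x s * a x s

/-- The imaginary part `(A - A*) / (2 i)` of an operator. -/
def imPart {l : ℕ} (A : Algebra l) : Algebra l := (2 * Complex.I)⁻¹ • (A - Aᴴ)

/-- States: positive normalized linear functionals. -/
structure State (l : ℕ) where
  toLinearMap : Algebra l →ₗ[ℂ] ℂ
  nonneg : ∀ A : Algebra l, 0 ≤ toLinearMap (Aᴴ * A)
  map_one : toLinearMap 1 = 1

/-- The expectation value of a self-adjoint observable, as a real number. -/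
def State.expect {l : ℕ} (ρ : State l) (A : Algebra l) : ℝ := (ρ.toLinearMap A).re

/-- The density matrix `d_ρ` of a state, in the occupation number basis. -/
def State.density {l : ℕ} (ρ : State l) : Algebra l :=
  fun S T => ρ.toLinearMap (Matrix.single T S 1)

/-- The defining property of the density matrix: `ρ(A) = Trace (d_ρ A)`. -/
theorem State.trace_density_mul {l : ℕ} (ρ : State l) (A : Algebra l) :
    (ρ.density * A).trace = ρ.toLinearMap A := by
  conv_rhs => rw [Matrix.matrix_eq_sum_single A]
  simp only [map_sum, Matrix.trace, Matrix.diag, Matrix.mul_apply, State.density]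
  rw [Finset.sum_comm]
  refine Finset.sum_congr rfl fun S _ => Finset.sum_congr rfl fun T _ => ?_
  have h : Matrix.single S T (A S T) = A S T • Matrix.single S T (1 : ℂ) := by
    rw [Matrix.smul_single, smul_eq_mul, mul_one]
  rw [h, map_smul, smul_eq_mul, mul_comm]

/-- The density matrix is self-adjoint, so that functional calculus applies to it. -/
theorem State.density_isHermitian {l : ℕ} (ρ : State l) : ρ.density.IsHermitian := by
  have key : ∀ A : Algebra l, ρ.toLinearMap Aᴴ = star (ρ.toLinearMap A) := by
    intro A
    have real : ∀ C : Algebra l, (ρ.toLinearMap (Cᴴ * C)).im = 0 := fun C =>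
      (Complex.nonneg_iff.1 (ρ.nonneg C)).2.symm
    have e1 := real (A + 1)
    have e2 := real (A + Complex.I • (1 : Algebra l))
    have e0 := real A
    simp [add_mul, mul_add, ρ.map_one, e0] at e1 e2
    apply Complex.ext <;> simp <;> linarith
  ext S T
  rw [Matrix.conjTranspose_apply]
  simp only [State.density]
  rw [← key, Matrix.conjTranspose_single, star_one]

/-- The von Neumann entropy `Trace (η (d_ρ))`, with `η(t) = -t log t` applied by functional
calculus. -/
def entropy {l : ℕ} (ρ : State l) : ℝ := (Matrix.trace (cfc Real.negMulLog ρ.density)).re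

/-! ### Hamiltonian and free-energy density -/

/-- The strong coupling BCS-Hubbard Hamiltonian without magnetic induction. -/
def hamiltonianT (μ lam γ : ℝ) (l : ℕ) : Algebra l :=
  -((μ : ℂ) • ∑ x : box l, (num x up + num x dn))
    + ((2 * lam : ℝ) : ℂ) • ∑ x : box l, num x up * num x dn
    - ((γ / (box l).card : ℝ) : ℂ) •
        ∑ x : box l, ∑ y : box l, aStar x up * aStar x dn * a y dn * a y up

/-- `∫ bᵢ((x + y) / (2 l)) dy` over the unit cell `y ∈ [-1/2, 1/2]³`. The field `B` lives on the
unit cube and is extended by zero, since cells of some boundary sites stick out of the box. -/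
def cellField (B : Space → Space) (l : ℕ) (x : Site) (i : Fin 3) : ℝ :=
  ∫ y in cube, (cube.indicator B ((2 * (l : ℝ))⁻¹ • (x.toSpace + y))) i

/-- The interaction between spins and the magnetic induction `B`. -/
def hamiltonianM (ϑ : ℝ) (B : Space → Space) (l : ℕ) : Algebra l :=
  -((ϑ : ℂ) • ∑ x : box l,
      (cellField B l x 0 : ℂ) • (aStar x up * a x dn + aStar x dn * a x up))
    + (Complex.I * (ϑ : ℂ)) • ∑ x : box l,
      (cellField B l x 1 : ℂ) • (aStar x up * a x dn - aStar x dn * a x up)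
    - (ϑ : ℂ) • ∑ x : box l, (cellField B l x 2 : ℂ) • (num x up - num x dn)

/-- The full Hamiltonian `H_l = T_l + M_l`. -/
def hamiltonian (μ lam γ ϑ : ℝ) (B : Space → Space) (l : ℕ) : Algebra l :=
  hamiltonianT μ lam γ l + hamiltonianM ϑ B l

/-- The free-energy density `f_l(B, ρ) = |Λ_l|⁻¹ (ρ(H_l) - β⁻¹ S_l(ρ))`. -/
def freeEnergyDensity (μ lam γ ϑ β : ℝ) (B : Space → Space) {l : ℕ} (ρ : State l) : ℝ :=
  ((box l).card : ℝ)⁻¹ * (ρ.expect (hamiltonian μ lam γ ϑ B l) - β⁻¹ * entropy ρ)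

/-! ### Currents -/

/-- The observable `I_l^{x,y}` of the current from `x` to `y`. -/
def currentObservable (γ : ℝ) {l : ℕ} (x y : box l) : Algebra l :=
  ((4 * γ / (box l).card : ℝ) : ℂ) • imPart (aStar x up * aStar x dn * a y dn * a y up)

/-- Admissible current profiles: smooth, compactly supported, spherically symmetric, nonnegative,
positive at the origin, and normalized on `ℝ³` and on the plane `{0} × ℝ²`. -/
structure IsCurrentProfile (ξ : Space → ℝ) : Prop where
  smooth : ContDiff ℝ ∞ ξ
  compactSupport : HasCompactSupport ξ
  radial : ∀ s t : Space, ‖s‖ = ‖t‖ → ξ s = ξ t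
  nonneg : ∀ t, 0 ≤ ξ t
  pos_zero : 0 < ξ 0
  integral_eq_one : ∫ t, ξ t = 1
  integral_plane_eq_one : ∫ p : ℝ × ℝ, ξ !₂[0, p.1, p.2] = 1

/-- The current density `j_ρ` at `x ∈ ℝ³`. -/
def currentDensity (γ : ℝ) (ξ : Space → ℝ) {l : ℕ} (ρ : State l) (x : Space) : Space :=
  ∑ y : box l, ∑ z : box l, if y = z then 0 else
    let v : Space := Site.toSpace z - Site.toSpace y
    let c : Space := (2⁻¹ : ℝ) • (Site.toSpace y + Site.toSpace z)
    (ξ (‖v‖⁻¹ • (x - c)) * ρ.expect (currentObservable γ y z) / ‖v‖ ^ 3) • v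

/-- The rescaled current density `j_ρ^{(l)}(t) = 2 l j_ρ(2 l t)`. -/
def rescaledCurrentDensity (γ : ℝ) (ξ : Space → ℝ) {l : ℕ} (ρ : State l) (t : Space) : Space :=
  (2 * (l : ℝ)) • currentDensity γ ξ ρ ((2 * (l : ℝ)) • t)

end BCSHubbard

end

namespace BCSHubbard

/-! ### Traces of functions of Hermitian matrices -/

section SpectralTraces

variable {n : Type*} [Fintype n] [DecidableEq n]

/-! Write `D = 2l`. Any current density can be superposed on an almost minimizing state because
carrying it needs only a fraction of order `D⁻²` of another state, while free-energy densities are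
at most of order `D^(3/2)`. The background is made free of currents. Transposition followed by a
gauge transformation, with phases adapted to the planar magnetic field at each site, fixes the
Hamiltonian, preserves entropy and reverses every pair hop. Averaging a state with its image
therefore cancels all currents, and convexity of the free energy (concavity of entropy, from
Peierls' inequality) shows that nothing is lost: `exists_freeEnergyDensity_le_currentFree`. The
currents come from product states of pairs. A relative phase `i` between two clusters of sites
drives a current of strength `γ / |Λ|` between any two of their sites (`exists_state_current`).
Clusters of macroscopic size around `p` and `q` contain about `D⁶` pairs of sites, so the rescaled
current is of order `D²`, and weight `D⁻²` produces a multiple of the profile `bump ξ p q`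
(`isCurrentLimit_bump`). Fields reachable in this way (`IsCurrentLimit`) form a uniformly closed
convex cone. It contains all rescaled copies of `ξ` centred well inside the cube, times any vector,
hence their integrals, hence mollifications of a continuous field that vanishes outside the cube,
hence that field itself (`isCurrentLimit_of_continuous`). Square integrability of the induction
bounds its cell averages by a multiple of `D^(3/2)` (`exists_abs_cellField_le`). Mixing with weight
of order `D⁻²` then costs `O(D^(-1/2))` in free-energy density (`eventually_exists_state`), and a
diagonal choice yields one sequence of states. -/

theorem trace_cfc_eq_sum {A : Matrix n n ℂ} (hA : A.IsHermitian) (f : ℝ → ℝ) :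
    (Matrix.trace (cfc f A)).re = ∑ i, f (hA.eigenvalues i) := by
  rw [hA.cfc_eq, Matrix.IsHermitian.cfc, Unitary.conjStarAlgAut_apply, Matrix.trace_mul_cycle]
  simp [Matrix.trace_diagonal]

theorem trace_cfc_congr_charpoly {A B : Matrix n n ℂ} (hA : A.IsHermitian) (hB : B.IsHermitian)
    (h : A.charpoly = B.charpoly) (f : ℝ → ℝ) :
    (Matrix.trace (cfc f A)).re = (Matrix.trace (cfc f B)).re := by
  rw [trace_cfc_eq_sum hA, trace_cfc_eq_sum hB, (hA.eigenvalues_eq_eigenvalues_iff hB).2 h]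

/-- The diagonal of a Hermitian matrix in any orthonormal basis is the image of its eigenvalues
under a doubly stochastic matrix. -/
theorem exists_doublyStochastic_diag {A : Matrix n n ℂ} (hA : A.IsHermitian)
    (U : Matrix.unitaryGroup n ℂ) :
    ∃ P : n → n → ℝ, (∀ i k, 0 ≤ P i k) ∧ (∀ i, ∑ k, P i k = 1) ∧ (∀ k, ∑ i, P i k = 1) ∧
      ∀ i, ((star (U : Matrix n n ℂ) * A * (U : Matrix n n ℂ)) i i).re
        = ∑ k, P i k * hA.eigenvalues k := by
  -- `W` is the unitary change between the given basis and an eigenbasis. The weights are `|W i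
  -- k|²`, whose row and column sums are 1 by unitarity.
  set W : Matrix n n ℂ := star (U : Matrix n n ℂ) * (hA.eigenvectorUnitary : Matrix n n ℂ) with hW
  have hUU : (U : Matrix n n ℂ) * star (U : Matrix n n ℂ) = 1 := Unitary.coe_mul_star_self U
  have hUU' : star (U : Matrix n n ℂ) * (U : Matrix n n ℂ) = 1 := Unitary.coe_star_mul_self U
  have hVV : (hA.eigenvectorUnitary : Matrix n n ℂ) * star (hA.eigenvectorUnitary : Matrix n n ℂ)
      = 1 := Unitary.coe_mul_star_self _
  have hVV' : star (hA.eigenvectorUnitary : Matrix n n ℂ) * (hA.eigenvectorUnitary : Matrix n n ℂ)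
      = 1 := Unitary.coe_star_mul_self _
  have h1 : W * star W = 1 := by
    rw [hW, star_mul, star_star, mul_assoc, ← mul_assoc _ (star _) (U : Matrix n n ℂ), hVV,
      one_mul, hUU']
  have h2 : star W * W = 1 := by
    rw [hW, star_mul, star_star, mul_assoc, ← mul_assoc (U : Matrix n n ℂ), hUU, one_mul, hVV']
  refine ⟨fun i k => Complex.normSq (W i k), fun i k => Complex.normSq_nonneg _, fun i => ?_,
    fun k => ?_, fun i => ?_⟩
  · have := congrFun (congrFun h1 i) i
    simp only [Matrix.mul_apply, Matrix.star_apply, Matrix.one_apply_eq] at this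
    have := congrArg Complex.re this
    simpa [Complex.mul_conj] using this
  · have := congrFun (congrFun h2 k) k
    simp only [Matrix.mul_apply, Matrix.star_apply, Matrix.one_apply_eq] at this
    have := congrArg Complex.re this
    simpa [← Complex.normSq_eq_conj_mul_self] using this
  · have h3 : star (U : Matrix n n ℂ) * A * (U : Matrix n n ℂ)
        = W * Matrix.diagonal (RCLike.ofReal ∘ hA.eigenvalues) * star W := by
      conv_lhs => rw [hA.spectral_theorem, Unitary.conjStarAlgAut_apply]
      rw [hW, star_mul, star_star]
      simp only [mul_assoc]
    rw [h3, Matrix.mul_apply, Complex.re_sum]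
    refine Finset.sum_congr rfl fun k _ => ?_
    rw [Matrix.mul_diagonal, Matrix.star_apply, mul_right_comm, Complex.star_def,
      Complex.mul_conj]
    simp

/-- Peierls' inequality: Jensen applies along each row of the doubly stochastic matrix, and the
column sums restore the sum over the spectrum. -/
theorem trace_cfc_le_sum_diag {A : Matrix n n ℂ} (hA : A.PosSemidef) {f : ℝ → ℝ}
    (hf : ConcaveOn ℝ (Set.Ici 0) f) (U : Matrix.unitaryGroup n ℂ) :
    (Matrix.trace (cfc f A)).re ≤
      ∑ i, f ((star (U : Matrix n n ℂ) * A * (U : Matrix n n ℂ)) i i).re := by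
  obtain ⟨P, h0, h1, h2, h3⟩ := exists_doublyStochastic_diag hA.isHermitian U
  rw [trace_cfc_eq_sum hA.isHermitian]
  calc ∑ k, f (hA.isHermitian.eigenvalues k)
      = ∑ k, ∑ i, P i k * f (hA.isHermitian.eigenvalues k) :=
        Finset.sum_congr rfl fun k _ => by rw [← Finset.sum_mul, h2, one_mul]
    _ = ∑ i, ∑ k, P i k • f (hA.isHermitian.eigenvalues k) := Finset.sum_comm
    _ ≤ _ := Finset.sum_le_sum fun i _ => by
        rw [h3]
        exact hf.le_map_sum (fun k _ => h0 i k) (h1 i) fun k _ => hA.eigenvalues_nonneg k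

/-- Concavity of `A ↦ Trace (f A)` on positive semidefinite matrices, for concave `f`. -/
theorem trace_cfc_concave {A B : Matrix n n ℂ} (hA : A.PosSemidef) (hB : B.PosSemidef)
    {f : ℝ → ℝ} (hf : ConcaveOn ℝ (Set.Ici 0) f) {p q : ℝ} (hp : 0 ≤ p) (hq : 0 ≤ q)
    (hpq : p + q = 1) :
    p * (Matrix.trace (cfc f A)).re + q * (Matrix.trace (cfc f B)).re ≤
      (Matrix.trace (cfc f ((p : ℂ) • A + (q : ℂ) • B))).re := by
  have hC : ((p : ℂ) • A + (q : ℂ) • B).PosSemidef :=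
    (hA.smul (by exact_mod_cast hp)).add (hB.smul (by exact_mod_cast hq))
  -- In the eigenbasis of the combination its diagonal is its spectrum. Peierls' inequality for `A`
  -- and `B` in this basis reduces the claim to scalar concavity, entry by entry.
  set U := hC.isHermitian.eigenvectorUnitary with hU
  rw [trace_cfc_eq_sum hC.isHermitian]
  have hdiag : ∀ {M : Matrix n n ℂ}, M.PosSemidef → ∀ i,
      0 ≤ ((star (U : Matrix n n ℂ) * M * (U : Matrix n n ℂ)) i i).re := by
    intro M hM i
    have := hM.conjTranspose_mul_mul_same (U : Matrix n n ℂ)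
    exact (Complex.nonneg_iff.1 (this.diag_nonneg (i := i))).1
  have hev : ∀ i, hC.isHermitian.eigenvalues i
      = p * ((star (U : Matrix n n ℂ) * A * (U : Matrix n n ℂ)) i i).re
        + q * ((star (U : Matrix n n ℂ) * B * (U : Matrix n n ℂ)) i i).re := by
    intro i
    have h := hC.isHermitian.conjStarAlgAut_star_eigenvectorUnitary
    rw [Unitary.conjStarAlgAut_star_apply] at h
    have h' := congrArg Complex.re (congrFun (congrFun h i) i)
    rw [← hU] at h'
    simp only [mul_add, add_mul, Matrix.mul_smul, Matrix.smul_mul, Matrix.add_apply,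
      Matrix.smul_apply, smul_eq_mul, Complex.add_re, Complex.re_ofReal_mul,
      Matrix.diagonal_apply_eq] at h'
    rw [h']
    simp
  calc _ ≤ p * ∑ i, f ((star (U : Matrix n n ℂ) * A * (U : Matrix n n ℂ)) i i).re
        + q * ∑ i, f ((star (U : Matrix n n ℂ) * B * (U : Matrix n n ℂ)) i i).re :=
        add_le_add (mul_le_mul_of_nonneg_left (trace_cfc_le_sum_diag hA hf U) hp)
          (mul_le_mul_of_nonneg_left (trace_cfc_le_sum_diag hB hf U) hq)
    _ ≤ _ := by
        rw [Finset.mul_sum, Finset.mul_sum, ← Finset.sum_add_distrib]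
        refine Finset.sum_le_sum fun i _ => ?_
        rw [hev]
        exact hf.2 (hdiag hA i) (hdiag hB i) hp hq hpq

theorem trace_cfc_negMulLog_nonneg {A : Matrix n n ℂ} (hA : A.PosSemidef) (h1 : A.trace = 1) :
    0 ≤ (Matrix.trace (cfc Real.negMulLog A)).re := by
  rw [trace_cfc_eq_sum hA.isHermitian]
  have hs : ∑ i, hA.isHermitian.eigenvalues i = 1 := by
    have := hA.isHermitian.trace_eq_sum_eigenvalues
    rw [h1] at this
    simpa using (congrArg Complex.re this).symm
  refine Finset.sum_nonneg fun i _ => Real.negMulLog_nonneg (hA.eigenvalues_nonneg i) ?_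
  rw [← hs]
  exact Finset.single_le_sum (fun k _ => hA.eigenvalues_nonneg k) (Finset.mem_univ i)

theorem trace_cfc_negMulLog_le {A : Matrix n n ℂ} [Nonempty n] (hA : A.PosSemidef)
    (h1 : A.trace = 1) :
    (Matrix.trace (cfc Real.negMulLog A)).re ≤ Real.log (Fintype.card n) := by
  rw [trace_cfc_eq_sum hA.isHermitian]
  have hs : ∑ i, hA.isHermitian.eigenvalues i = 1 := by
    have := hA.isHermitian.trace_eq_sum_eigenvalues
    rw [h1] at this
    simpa using (congrArg Complex.re this).symm
  have hN : (0 : ℝ) < Fintype.card n := by exact_mod_cast Fintype.card_pos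
  -- This is `log y ≤ y - 1` at `y = 1 / (N x)`. The correction `1 / N - x` sums to zero over the
  -- spectrum.
  have key : ∀ x : ℝ, 0 ≤ x →
      Real.negMulLog x ≤ x * Real.log (Fintype.card n) + (Fintype.card n : ℝ)⁻¹ - x := by
    intro x hx
    rcases hx.eq_or_lt with rfl | hx
    · simp
    · have h2 := Real.log_le_sub_one_of_pos (x := ((Fintype.card n : ℝ) * x)⁻¹) (by positivity)
      rw [Real.log_inv, Real.log_mul hN.ne' hx.ne'] at h2
      have h3 := mul_le_mul_of_nonneg_left h2 hx.le
      have h4 : x * (((Fintype.card n : ℝ) * x)⁻¹ - 1) = (Fintype.card n : ℝ)⁻¹ - x := by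
        field_simp
      rw [h4] at h3
      rw [Real.negMulLog]
      linarith
  calc _ ≤ ∑ i, (hA.isHermitian.eigenvalues i * Real.log (Fintype.card n)
        + (Fintype.card n : ℝ)⁻¹ - hA.isHermitian.eigenvalues i) :=
        Finset.sum_le_sum fun i _ => key _ (hA.eigenvalues_nonneg i)
    _ = _ := by
        rw [Finset.sum_sub_distrib, Finset.sum_add_distrib, ← Finset.sum_mul, hs]
        simp [hN.ne']

end SpectralTraces

/-! ### States -/

theorem State.map_conjTranspose {l : ℕ} (ρ : State l) (A : Algebra l) :
    ρ.toLinearMap Aᴴ = star (ρ.toLinearMap A) := by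
  have hd : ∀ B : Algebra l, star (ρ.density * B).trace = (ρ.density * Bᴴ).trace := by
    intro B
    rw [← Matrix.trace_conjTranspose, Matrix.conjTranspose_mul, ρ.density_isHermitian,
      Matrix.trace_mul_comm]
  rw [← ρ.trace_density_mul, ← ρ.trace_density_mul, hd]

theorem State.trace_density {l : ℕ} (ρ : State l) : ρ.density.trace = 1 := by
  rw [← mul_one ρ.density, ρ.trace_density_mul, ρ.map_one]

theorem State.density_posSemidef {l : ℕ} (ρ : State l) : ρ.density.PosSemidef := by
  refine Matrix.PosSemidef.of_dotProduct_mulVec_nonneg ρ.density_isHermitian fun x => ?_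
  by_cases hne : Nonempty (Finset (Mode l))
  · obtain ⟨S₀⟩ := hne
    -- For the operator `A` whose only nonzero row is `star x`, `Trace (d A* A)` is the quadratic
    -- form of the density matrix at `x`.
    have h := ρ.nonneg (Matrix.of fun S T => if S = S₀ then star (x T) else 0)
    rw [← ρ.trace_density_mul] at h
    convert h using 1
    simp [Matrix.trace, Matrix.mul_apply, dotProduct, Matrix.mulVec, Finset.mul_sum]
    refine Finset.sum_congr rfl fun S _ => Finset.sum_congr rfl fun T _ => ?_
    ring
  · exact absurd ⟨∅⟩ hne

theorem entropy_nonneg {l : ℕ} (ρ : State l) : 0 ≤ entropy ρ :=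
  trace_cfc_negMulLog_nonneg ρ.density_posSemidef ρ.trace_density

theorem card_mode (l : ℕ) : Fintype.card (Mode l) = 2 * (box l).card := by
  change Fintype.card (box l × Spin) = _
  simp [mul_comm]

theorem entropy_le {l : ℕ} (ρ : State l) : entropy ρ ≤ (box l).card * Real.log 4 := by
  refine (trace_cfc_negMulLog_le ρ.density_posSemidef ρ.trace_density).trans_eq ?_
  rw [Fintype.card_finset, card_mode, pow_mul]
  push_cast
  rw [Real.log_pow]

/-- The convex combination `p ρ + q σ` of states. -/
def State.mix {l : ℕ} (ρ σ : State l) (p q : ℝ) (hp : 0 ≤ p) (hq : 0 ≤ q) (hpq : p + q = 1) :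
    State l where
  toLinearMap := (p : ℂ) • ρ.toLinearMap + (q : ℂ) • σ.toLinearMap
  nonneg A := by
    simp only [LinearMap.add_apply, LinearMap.smul_apply, smul_eq_mul]
    exact add_nonneg (mul_nonneg (by exact_mod_cast hp) (ρ.nonneg A))
      (mul_nonneg (by exact_mod_cast hq) (σ.nonneg A))
  map_one := by
    simp only [LinearMap.add_apply, LinearMap.smul_apply, smul_eq_mul, ρ.map_one, σ.map_one,
      mul_one]
    exact_mod_cast hpq

section Mix

variable {l : ℕ} (ρ σ : State l) {p q : ℝ} (hp : 0 ≤ p) (hq : 0 ≤ q) (hpq : p + q = 1)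

theorem State.expect_mix (A : Algebra l) :
    (ρ.mix σ p q hp hq hpq).expect A = p * ρ.expect A + q * σ.expect A := by
  simp [State.expect, State.mix]

theorem entropy_mix_ge :
    p * entropy ρ + q * entropy σ ≤ entropy (ρ.mix σ p q hp hq hpq) :=
  trace_cfc_concave ρ.density_posSemidef σ.density_posSemidef Real.concaveOn_negMulLog hp hq hpq

theorem freeEnergyDensity_mix_le (μ lam γ ϑ : ℝ) {β : ℝ} (hβ : 0 < β) (B : Space → Space) :
    freeEnergyDensity μ lam γ ϑ β B (ρ.mix σ p q hp hq hpq) ≤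
      p * freeEnergyDensity μ lam γ ϑ β B ρ + q * freeEnergyDensity μ lam γ ϑ β B σ := by
  have h := mul_le_mul_of_nonneg_left (entropy_mix_ge ρ σ hp hq hpq) (inv_nonneg.2 hβ.le)
  have hN : (0 : ℝ) ≤ ((box l).card : ℝ)⁻¹ := by positivity
  simp only [freeEnergyDensity, State.expect_mix]
  calc _ ≤ ((box l).card : ℝ)⁻¹ * (p * ρ.expect (hamiltonian μ lam γ ϑ B l)
        + q * σ.expect (hamiltonian μ lam γ ϑ B l)
        - β⁻¹ * (p * entropy ρ + q * entropy σ)) := by gcongr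
    _ = _ := by ring

theorem rescaledCurrentDensity_mix (γ : ℝ) (ξ : Space → ℝ) (t : Space) :
    rescaledCurrentDensity γ ξ (ρ.mix σ p q hp hq hpq) t =
      p • rescaledCurrentDensity γ ξ ρ t + q • rescaledCurrentDensity γ ξ σ t := by
  simp only [rescaledCurrentDensity, currentDensity]
  rw [smul_comm p, smul_comm q, ← smul_add]
  congr 1
  simp only [Finset.smul_sum]
  rw [← Finset.sum_add_distrib]
  refine Finset.sum_congr rfl fun y _ => ?_
  rw [← Finset.sum_add_distrib]
  refine Finset.sum_congr rfl fun z _ => ?_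
  split_ifs with h
  · simp
  · rw [smul_smul, smul_smul, ← add_smul, State.expect_mix]
    congr 1
    ring

end Mix


/-! ### Norm bounds -/

theorem annihilate_conjTranspose_mul_self {l : ℕ} (m : Mode l) :
    (annihilate m)ᴴ * annihilate m = Matrix.diagonal fun S => if m ∈ S then (1 : ℂ) else 0 := by
  ext T S
  rw [Matrix.mul_apply, Finset.sum_eq_single (S.erase m)]
  · by_cases hS : m ∈ S
    · by_cases hTS : T = S
      · subst hTS
        simp [Matrix.conjTranspose_apply, annihilate, hS, ← mul_pow]
      · have h : ¬ (m ∈ T ∧ S.erase m = T.erase m) := fun h => hTS <| by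
          rw [← Finset.insert_erase h.1, ← h.2, Finset.insert_erase hS]
        simp [Matrix.conjTranspose_apply, annihilate, h, Matrix.diagonal_apply_ne _ hTS]
    · by_cases hTS : T = S
      · subst hTS
        simp [annihilate, hS]
      · simp [annihilate, hS, Matrix.diagonal_apply_ne _ hTS]
  · intro R _ hR
    simp [annihilate, hR]
  · simp

theorem num_eq_diagonal {l : ℕ} (x : box l) (s : Spin) :
    num x s = Matrix.diagonal fun S => if (show Mode l from (x, s)) ∈ S then (1 : ℂ) else 0 :=
  annihilate_conjTranspose_mul_self _

section Order

open scoped MatrixOrder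

theorem State.nonneg_of_posSemidef {l : ℕ} (ρ : State l) {A : Algebra l} (hA : A.PosSemidef) :
    0 ≤ ρ.toLinearMap A := by
  obtain ⟨B, rfl⟩ := CStarAlgebra.nonneg_iff_eq_star_mul_self.mp hA.nonneg
  exact ρ.nonneg B

end Order

section Norm

open scoped Matrix.Norms.L2Operator

theorem norm_diagonal_indicator_le {l : ℕ} (m : Mode l) :
    ‖(Matrix.diagonal fun S => if m ∈ S then (1 : ℂ) else 0 : Algebra l)‖ ≤ 1 := by
  rw [Matrix.l2_opNorm_diagonal]
  refine (pi_norm_le_iff_of_nonneg zero_le_one).2 fun S => ?_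
  split_ifs <;> simp

theorem norm_annihilate_le {l : ℕ} (m : Mode l) : ‖annihilate m‖ ≤ 1 := by
  have h := Matrix.l2_opNorm_conjTranspose_mul_self (annihilate m)
  rw [annihilate_conjTranspose_mul_self] at h
  have := norm_diagonal_indicator_le m
  nlinarith [norm_nonneg (annihilate m)]

theorem norm_a_le {l : ℕ} (x : box l) (s : Spin) : ‖a x s‖ ≤ 1 := norm_annihilate_le _

theorem norm_aStar_le {l : ℕ} (x : box l) (s : Spin) : ‖aStar x s‖ ≤ 1 := by
  rw [aStar, Matrix.l2_opNorm_conjTranspose]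
  exact norm_a_le x s

theorem norm_mul_le_one {l : ℕ} {A B : Algebra l} (hA : ‖A‖ ≤ 1) (hB : ‖B‖ ≤ 1) :
    ‖A * B‖ ≤ 1 :=
  (norm_mul_le A B).trans (mul_le_one₀ hA (norm_nonneg _) hB)

theorem norm_num_le {l : ℕ} (x : box l) (s : Spin) : ‖num x s‖ ≤ 1 :=
  norm_mul_le_one (norm_aStar_le x s) (norm_a_le x s)

theorem norm_sum_box_le {l : ℕ} {f : box l → Algebra l} {c : ℝ} (h : ∀ x, ‖f x‖ ≤ c) :
    ‖∑ x, f x‖ ≤ (box l).card * c := by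
  refine (norm_sum_le_of_le _ fun x _ => h x).trans_eq ?_
  simp

/-- Expectation values are bounded by the operator norm. -/
theorem State.norm_map_le {l : ℕ} (ρ : State l) (A : Algebra l) :
    ‖ρ.toLinearMap A‖ ≤ ‖A‖ := by
  -- The variance of `A` in the state is nonnegative.
  have h1 : ‖ρ.toLinearMap A‖ ^ 2 ≤ (ρ.toLinearMap (Aᴴ * A)).re := by
    have h := (Complex.nonneg_iff.1
      (ρ.nonneg (A - (ρ.toLinearMap A) • (1 : Algebra l)))).1
    simp only [Matrix.conjTranspose_sub, Matrix.conjTranspose_smul, Matrix.conjTranspose_one,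
      sub_mul, mul_sub, Matrix.smul_mul, Matrix.mul_smul, one_mul, mul_one, map_sub, map_smul,
      ρ.map_one, ρ.map_conjTranspose, smul_eq_mul, Complex.sub_re] at h
    rw [Complex.sq_norm, Complex.normSq_apply]
    simp only [Complex.star_def, Complex.mul_re, Complex.conj_re, Complex.conj_im] at h
    linarith
  have h2 : (ρ.toLinearMap (Aᴴ * A)).re ≤ ‖A‖ ^ 2 := by
    have hpos : (((‖A‖ ^ 2 : ℝ) : ℂ) • (1 : Algebra l) - Aᴴ * A).PosSemidef := by
      refine Matrix.PosSemidef.of_dotProduct_mulVec_nonneg ?_ fun x => ?_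
      · refine Matrix.IsHermitian.sub ?_ (Matrix.isHermitian_conjTranspose_mul_self A)
        rw [Matrix.IsHermitian, Matrix.conjTranspose_smul, Matrix.conjTranspose_one]
        simp
      · rw [Matrix.sub_mulVec, dotProduct_sub, Matrix.smul_mulVec, Matrix.one_mulVec,
          dotProduct_smul, ← Matrix.mulVec_mulVec, Matrix.dotProduct_mulVec,
          ← Matrix.star_mulVec]
        have h3 := A.l2_opNorm_mulVec (WithLp.toLp 2 x)
        have h4 := mul_self_le_mul_self (norm_nonneg _) h3
        have e : ∀ y : Finset (Mode l) → ℂ,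
            star y ⬝ᵥ y = ((‖WithLp.toLp 2 y‖ * ‖WithLp.toLp 2 y‖ : ℝ) : ℂ) := by
          intro y
          rw [← sq, EuclideanSpace.norm_sq_eq]
          simp [dotProduct, Complex.conj_mul']
        rw [e, e, smul_eq_mul, sub_nonneg, ← Complex.ofReal_mul]
        have h5 : ‖WithLp.toLp 2 (A *ᵥ x)‖ * ‖WithLp.toLp 2 (A *ᵥ x)‖ ≤
            ‖A‖ ^ 2 * (‖WithLp.toLp 2 x‖ * ‖WithLp.toLp 2 x‖) := by
          refine le_trans h4 (le_of_eq ?_)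
          ring
        exact_mod_cast h5
    have h6 := ρ.nonneg_of_posSemidef hpos
    rw [map_sub, map_smul, ρ.map_one] at h6
    have := (Complex.nonneg_iff.1 h6).1
    simp only [smul_eq_mul, mul_one, Complex.sub_re, Complex.ofReal_re] at this
    linarith
  exact (sq_le_sq₀ (norm_nonneg _) (norm_nonneg _)).1 (h1.trans h2)

end Norm

/-! ### An antiunitary symmetry -/

/-- The phase which the gauge transformation with phases `ζ` gives to a basis vector. -/
noncomputable def phase {l : ℕ} (ζ : Mode l → ℂ) (S : Finset (Mode l)) : ℂ := ∏ m ∈ S, ζ m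

/-- The gauge transformation with phases `ζ`. -/
noncomputable def gauge {l : ℕ} (ζ : Mode l → ℂ) : Algebra l := Matrix.diagonal (phase ζ)

/-- Transposition followed by a gauge transformation. -/
noncomputable def reflect {l : ℕ} (ζ : Mode l → ℂ) : Algebra l →ₗ[ℂ] Algebra l where
  toFun A := (gauge ζ)ᴴ * Aᵀ * gauge ζ
  map_add' A B := by simp [mul_add, add_mul]
  map_smul' c A := by simp

section Reflect

variable {l : ℕ} {ζ : Mode l → ℂ}

theorem reflect_apply (A : Algebra l) : reflect ζ A = (gauge ζ)ᴴ * Aᵀ * gauge ζ := rfl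

theorem phase_star_mul_self (hζ : ∀ m, star (ζ m) * ζ m = 1) (S : Finset (Mode l)) :
    star (phase ζ S) * phase ζ S = 1 := by
  rw [phase, star_prod, ← Finset.prod_mul_distrib]
  exact Finset.prod_eq_one fun m _ => hζ m

theorem gauge_star_mul_self (hζ : ∀ m, star (ζ m) * ζ m = 1) :
    (gauge ζ)ᴴ * gauge ζ = 1 := by
  rw [gauge, Matrix.diagonal_conjTranspose, Matrix.diagonal_mul_diagonal, ← Matrix.diagonal_one]
  congr 1
  ext S : 1
  exact phase_star_mul_self hζ S

theorem gauge_mul_star_self (hζ : ∀ m, star (ζ m) * ζ m = 1) :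
    gauge ζ * (gauge ζ)ᴴ = 1 :=
  mul_eq_one_comm.1 (gauge_star_mul_self hζ)

theorem reflect_one (hζ : ∀ m, star (ζ m) * ζ m = 1) : reflect ζ 1 = 1 := by
  rw [reflect_apply, Matrix.transpose_one, mul_one, gauge_star_mul_self hζ]

theorem reflect_mul (hζ : ∀ m, star (ζ m) * ζ m = 1) (A B : Algebra l) :
    reflect ζ (A * B) = reflect ζ B * reflect ζ A := by
  simp only [reflect_apply, Matrix.transpose_mul]
  rw [mul_assoc _ (gauge ζ) (_ * _), ← mul_assoc (gauge ζ), ← mul_assoc (gauge ζ),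
    gauge_mul_star_self hζ, one_mul]
  simp only [mul_assoc]

theorem reflect_conjTranspose (A : Algebra l) : reflect ζ Aᴴ = (reflect ζ A)ᴴ := by
  simp only [reflect_apply, Matrix.conjTranspose_mul, Matrix.conjTranspose_conjTranspose,
    mul_assoc]
  rfl

/-- The entries of `annihilate m` are real, so transposition acts as the adjoint; the phases of `S`
and `S.erase m` differ by the factor `ζ m`. -/
theorem reflect_annihilate (hζ : ∀ m, star (ζ m) * ζ m = 1) (m : Mode l) :
    reflect ζ (annihilate m) = star (ζ m) • (annihilate m)ᴴ := by
  ext S T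
  rw [reflect_apply, gauge, Matrix.diagonal_conjTranspose, Matrix.mul_diagonal,
    Matrix.diagonal_mul, Matrix.smul_apply, Matrix.conjTranspose_apply, Matrix.transpose_apply,
    annihilate, Pi.star_apply, smul_eq_mul]
  split_ifs with h
  · have h1 : phase ζ S = ζ m * phase ζ T := by
      rw [h.2, phase, phase, Finset.mul_prod_erase _ _ h.1]
    rw [h1, star_mul']
    simp only [star_pow, star_neg, star_one]
    linear_combination (star (ζ m) * (-1) ^ (S.filter (· < m)).card) * phase_star_mul_self hζ T
  · simp

/-- The pair hopping term `a*_{x,↑} a*_{x,↓} a_{y,↓} a_{y,↑}`. -/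
noncomputable def pairHop (x y : box l) : Algebra l := aStar x up * aStar x dn * a y dn * a y up

theorem pairHop_conjTranspose (x y : box l) : (pairHop x y)ᴴ = pairHop y x := by
  simp only [pairHop, aStar, Matrix.conjTranspose_mul, Matrix.conjTranspose_conjTranspose,
    mul_assoc]

/-- The gauge phases `u` for spin `↑` and `conj u` for spin `↓`. -/
noncomputable def spinPhase (u : box l → ℂ) : Mode l → ℂ := fun m => if m.2 = up then u m.1 else star (u m.1)

theorem spinPhase_star_mul_self {u : box l → ℂ} (hu : ∀ x, star (u x) * u x = 1)
    (m : Mode l) :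
    star (spinPhase u m) * spinPhase u m = 1 := by
  unfold spinPhase
  split_ifs
  · exact hu _
  · rw [star_star, mul_comm]
    exact hu _

theorem reflect_a_up {u : box l → ℂ} (hu : ∀ x, star (u x) * u x = 1)
    (x : box l) :
    reflect (spinPhase u) (a x up) = star (u x) • aStar x up :=
  reflect_annihilate (spinPhase_star_mul_self hu) _

theorem reflect_a_dn {u : box l → ℂ} (hu : ∀ x, star (u x) * u x = 1)
    (x : box l) :
    reflect (spinPhase u) (a x dn) = u x • aStar x dn := by
  refine (reflect_annihilate (spinPhase_star_mul_self hu) _).trans ?_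
  simp [spinPhase, aStar, a]

theorem reflect_aStar_up {u : box l → ℂ} (hu : ∀ x, star (u x) * u x = 1) (x : box l) :
    reflect (spinPhase u) (aStar x up) = u x • a x up := by
  rw [aStar, reflect_conjTranspose, reflect_a_up hu, Matrix.conjTranspose_smul, star_star, aStar,
    Matrix.conjTranspose_conjTranspose]

theorem reflect_aStar_dn {u : box l → ℂ} (hu : ∀ x, star (u x) * u x = 1) (x : box l) :
    reflect (spinPhase u) (aStar x dn) = star (u x) • a x dn := by
  rw [aStar, reflect_conjTranspose, reflect_a_dn hu, Matrix.conjTranspose_smul, aStar,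
    Matrix.conjTranspose_conjTranspose]

theorem reflect_num_up {u : box l → ℂ} (hu : ∀ x, star (u x) * u x = 1) (x : box l) :
    reflect (spinPhase u) (num x up) = num x up := by
  rw [num, reflect_mul (spinPhase_star_mul_self hu), reflect_a_up hu, reflect_aStar_up hu,
    smul_mul_smul_comm, hu, one_smul]

theorem reflect_num_dn {u : box l → ℂ} (hu : ∀ x, star (u x) * u x = 1) (x : box l) :
    reflect (spinPhase u) (num x dn) = num x dn := by
  rw [num, reflect_mul (spinPhase_star_mul_self hu), reflect_a_dn hu, reflect_aStar_dn hu,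
    smul_mul_smul_comm, mul_comm, hu, one_smul]

theorem reflect_num_mul_num {u : box l → ℂ} (hu : ∀ x, star (u x) * u x = 1) (x : box l) :
    reflect (spinPhase u) (num x up * num x dn) = num x up * num x dn := by
  rw [reflect_mul (spinPhase_star_mul_self hu), reflect_num_up hu, reflect_num_dn hu,
    num_eq_diagonal, num_eq_diagonal, Matrix.diagonal_mul_diagonal, Matrix.diagonal_mul_diagonal]
  simp only [mul_comm]

theorem reflect_flip_up {u : box l → ℂ} (hu : ∀ x, star (u x) * u x = 1) (x : box l) :
    reflect (spinPhase u) (aStar x up * a x dn) = u x ^ 2 • (aStar x dn * a x up) := by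
  rw [reflect_mul (spinPhase_star_mul_self hu), reflect_a_dn hu, reflect_aStar_up hu,
    smul_mul_smul_comm, sq]

theorem reflect_flip_dn {u : box l → ℂ} (hu : ∀ x, star (u x) * u x = 1) (x : box l) :
    reflect (spinPhase u) (aStar x dn * a x up) = star (u x) ^ 2 • (aStar x up * a x dn) := by
  rw [reflect_mul (spinPhase_star_mul_self hu), reflect_a_up hu, reflect_aStar_dn hu,
    smul_mul_smul_comm, sq]

/-- The opposite phases of the two spins cancel within a pair, and exchanging creation with
annihilation reverses the hop. This is what flips the sign of currents. -/
theorem reflect_pairHop {u : box l → ℂ} (hu : ∀ x, star (u x) * u x = 1) (x y : box l) :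
    reflect (spinPhase u) (pairHop x y) = pairHop y x := by
  have hζ := spinPhase_star_mul_self hu
  rw [pairHop, reflect_mul hζ, reflect_mul hζ, reflect_mul hζ, reflect_a_up hu, reflect_a_dn hu,
    reflect_aStar_up hu, reflect_aStar_dn hu]
  simp only [Matrix.smul_mul, Matrix.mul_smul, smul_smul, pairHop, mul_assoc]
  have h : u x * (star (u x) * (u y * star (u y))) = 1 := by
    linear_combination (star (u y) * u y) * hu x + hu y
  rw [h, one_smul]

theorem hamiltonianT_eq (μ lam γ : ℝ) (l : ℕ) : hamiltonianT μ lam γ l =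
    -((μ : ℂ) • ∑ x : box l, (num x up + num x dn))
    + ((2 * lam : ℝ) : ℂ) • ∑ x : box l, num x up * num x dn
    - ((γ / (box l).card : ℝ) : ℂ) • ∑ x : box l, ∑ y : box l, pairHop x y := rfl

theorem reflect_hamiltonianT {u : box l → ℂ} (hu : ∀ x, star (u x) * u x = 1) (μ lam γ : ℝ) :
    reflect (spinPhase u) (hamiltonianT μ lam γ l) = hamiltonianT μ lam γ l := by
  simp only [hamiltonianT_eq, map_add, map_sub, map_neg, map_smul, map_sum, reflect_num_up hu,
    reflect_num_dn hu, reflect_num_mul_num hu, reflect_pairHop hu]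
  rw [Finset.sum_comm (f := fun x y => pairHop y x)]

/-- Spin flips are exchanged and pick up `u²` or its conjugate; `huB` says that this exactly
compensates the exchange of their coefficients. -/
theorem reflect_hamiltonianM {u : box l → ℂ} (hu : ∀ x, star (u x) * u x = 1) (ϑ : ℝ)
    (B : Space → Space)
    (huB : ∀ x : box l, u x ^ 2 * (cellField B l x 0 - Complex.I * cellField B l x 1)
      = cellField B l x 0 + Complex.I * cellField B l x 1) :
    reflect (spinPhase u) (hamiltonianM ϑ B l) = hamiltonianM ϑ B l := by
  simp only [hamiltonianM, map_add, map_sub, map_neg, map_smul, map_sum, reflect_num_up hu,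
    reflect_num_dn hu, reflect_flip_up hu, reflect_flip_dn hu]
  rw [sub_left_inj]
  simp only [Finset.smul_sum, ← Finset.sum_neg_distrib, ← Finset.sum_add_distrib]
  refine Finset.sum_congr rfl fun x _ => ?_
  have h1 := huB x
  have h2 : star (u x) ^ 2 * (cellField B l x 0 + Complex.I * cellField B l x 1)
      = cellField B l x 0 - Complex.I * cellField B l x 1 := by
    rw [← h1]
    linear_combination (cellField B l x 0 - Complex.I * cellField B l x 1) *
      (star (u x) * u x + 1) * hu x
  generalize aStar x up * a x dn = P, aStar x dn * a x up = Q
  match_scalars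
  · linear_combination (-(ϑ : ℂ)) * h1
  · linear_combination (-(ϑ : ℂ)) * h2

/-- The phase is that of the planar field `w = b + i c`, since `w = (w / |w|)² * conj w`; any phase
works when `w = 0`. -/
theorem exists_spinPhase (b c : ℝ) : ∃ z : ℂ, star z * z = 1 ∧
    z ^ 2 * (b - Complex.I * c) = b + Complex.I * c := by
  set w : ℂ := b + Complex.I * c with hw
  have hw' : (b : ℂ) - Complex.I * c = star w := by simp [hw, sub_eq_add_neg]
  rw [hw']
  by_cases h : w = 0
  · exact ⟨1, by simp, by simp [h]⟩
  · have hn : (‖w‖ : ℂ) ≠ 0 := by simpa using h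
    have h2 : star w * w = (‖w‖ : ℂ) ^ 2 := by
      simpa using Complex.conj_mul' w
    refine ⟨w / ‖w‖, ?_, ?_⟩
    · rw [star_div₀, Complex.star_def, Complex.conj_ofReal]
      field_simp
      exact h2
    · field_simp
      linear_combination h2

end Reflect

/-- The state `A ↦ ρ (E* Aᵀ E)` with the gauge transformation `E`. -/
noncomputable def State.reflect {l : ℕ} (ρ : State l) (ζ : Mode l → ℂ)
    (hζ : ∀ m, star (ζ m) * ζ m = 1) : State l where
  toLinearMap := ρ.toLinearMap ∘ₗ BCSHubbard.reflect ζ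
  nonneg A := by
    rw [LinearMap.comp_apply, reflect_mul hζ, reflect_conjTranspose]
    have := ρ.nonneg (BCSHubbard.reflect ζ A)ᴴ
    rwa [Matrix.conjTranspose_conjTranspose] at this
  map_one := by rw [LinearMap.comp_apply, reflect_one hζ, ρ.map_one]

theorem State.expect_reflect {l : ℕ} (ρ : State l) {ζ : Mode l → ℂ}
    (hζ : ∀ m, star (ζ m) * ζ m = 1) (A : Algebra l) :
    (ρ.reflect ζ hζ).expect A = ρ.expect (BCSHubbard.reflect ζ A) := rfl

/-- The density matrix becomes the transpose of a unitary conjugate, with the same characteristic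
polynomial and hence the same spectrum. -/
theorem entropy_reflect {l : ℕ} (ρ : State l) {ζ : Mode l → ℂ}
    (hζ : ∀ m, star (ζ m) * ζ m = 1) : entropy (ρ.reflect ζ hζ) = entropy ρ := by
  have hd : (ρ.reflect ζ hζ).density = (gauge ζ * ρ.density * (gauge ζ)ᴴ)ᵀ := by
    ext S T
    rw [Matrix.transpose_apply, State.density]
    change ρ.toLinearMap ((gauge ζ)ᴴ * (Matrix.single T S 1)ᵀ * gauge ζ) = _
    rw [← ρ.trace_density_mul, Matrix.transpose_single, Matrix.trace_mul_comm, mul_assoc, mul_assoc,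
      Matrix.trace_mul_comm, mul_assoc, Matrix.trace_single_mul, one_smul]
  refine trace_cfc_congr_charpoly (State.density_isHermitian _) ρ.density_isHermitian ?_ _
  rw [hd, Matrix.charpoly_transpose, Matrix.charpoly_mul_comm, ← mul_assoc,
    gauge_star_mul_self hζ, one_mul]

theorem currentObservable_eq (γ : ℝ) {l : ℕ} (x y : box l) : currentObservable γ x y =
    ((4 * γ / (box l).card : ℝ) : ℂ) • (2 * Complex.I)⁻¹ • (pairHop x y - pairHop y x) := by
  rw [currentObservable, imPart, ← pairHop, pairHop_conjTranspose]

theorem State.expect_currentObservable {l : ℕ} (ρ : State l) (γ : ℝ) (x y : box l) :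
    ρ.expect (currentObservable γ x y) =
      4 * γ / (box l).card * (ρ.toLinearMap (pairHop x y)).im := by
  rw [currentObservable_eq, ← pairHop_conjTranspose x y, State.expect, map_smul, map_smul, map_sub,
    ρ.map_conjTranspose, smul_eq_mul, smul_eq_mul, Complex.re_ofReal_mul]
  congr 1
  set z := ρ.toLinearMap (pairHop x y)
  rw [Complex.star_def, Complex.sub_conj]
  have : (2 * Complex.I)⁻¹ * ((2 * z.im : ℝ) * Complex.I) = (z.im : ℂ) := by
    push_cast
    field_simp
  rw [this, Complex.ofReal_re]

/-- States with vanishing currents reach the infimum of the free-energy density. -/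
theorem exists_freeEnergyDensity_le_currentFree (μ lam γ ϑ : ℝ) {β : ℝ} (hβ : 0 < β)
    (B : Space → Space) {l : ℕ} (ρ : State l) : ∃ σ : State l,
      freeEnergyDensity μ lam γ ϑ β B σ ≤ freeEnergyDensity μ lam γ ϑ β B ρ ∧
      ∀ x y : box l, σ.expect (currentObservable γ x y) = 0 := by
  choose u hu huB using fun x : box l =>
    exists_spinPhase (cellField B l x 0) (cellField B l x 1)
  have hζ := spinPhase_star_mul_self hu
  set ρ' := ρ.reflect (spinPhase u) hζ with hρ'
  have hH : ρ'.expect (hamiltonian μ lam γ ϑ B l) = ρ.expect (hamiltonian μ lam γ ϑ B l) := by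
    rw [hρ', State.expect_reflect, hamiltonian, map_add, reflect_hamiltonianT hu,
      reflect_hamiltonianM hu ϑ B huB]
  have hf : freeEnergyDensity μ lam γ ϑ β B ρ' = freeEnergyDensity μ lam γ ϑ β B ρ := by
    rw [freeEnergyDensity, hH, hρ', entropy_reflect, freeEnergyDensity]
  -- The two states have equal free energies and opposite currents.
  refine ⟨ρ.mix ρ' (1 / 2) (1 / 2) (by norm_num) (by norm_num) (by norm_num), ?_, fun x y => ?_⟩
  · refine (freeEnergyDensity_mix_le _ _ _ _ _ μ lam γ ϑ hβ B).trans_eq ?_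
    rw [hf]
    ring
  · rw [State.expect_mix, hρ', State.expect_reflect, currentObservable_eq]
    simp only [map_smul, map_sub, reflect_pairHop hu]
    rw [← neg_sub (pairHop x y), smul_neg, smul_neg, State.expect, State.expect, map_neg,
      Complex.neg_re]
    ring


/-! ### Product states of pairs -/

/-- Both sides are the squared norm of `A` applied to the vector with amplitudes `χ` placed at `f`;
this gives positivity of vector states. -/
theorem sum_star_mul_conjTranspose_mul_self {n k : Type*} [Fintype n] [Fintype k]
    (A : Matrix n n ℂ) (f : k → n) (χ : k → ℂ) :
    ∑ X, ∑ Y, star (χ X) * (Aᴴ * A) (f X) (f Y) * χ Y =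
      ∑ T, star (∑ X, A T (f X) * χ X) * ∑ X, A T (f X) * χ X := by
  simp only [star_sum, Finset.sum_mul_sum]
  conv_rhs => rw [Finset.sum_comm]
  refine Finset.sum_congr rfl fun X _ => ?_
  conv_rhs => rw [Finset.sum_comm]
  refine Finset.sum_congr rfl fun Y _ => ?_
  rw [Matrix.mul_apply, Finset.mul_sum, Finset.sum_mul]
  refine Finset.sum_congr rfl fun T _ => ?_
  rw [Matrix.conjTranspose_apply, star_mul']
  ring

section PairStates

variable {l : ℕ}

/-- The mode `(x, s)`. -/
noncomputable def mode (x : box l) (s : Spin) : Mode l := (x, s)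

/-- The two spin modes of a site are neighbours in the order of modes. Hence the two fermionic signs
of `pairKill` coincide and cancel, and pairs behave like hard-core bosons. -/
theorem lt_mode_dn_iff (m : Mode l) (z : box l) : m < mode z dn ↔ m ≤ mode z up := by
  change toLex (toLex (m.1 : Site), m.2) < toLex (toLex (z : Site), dn) ↔
    toLex (toLex (m.1 : Site), m.2) ≤ toLex (toLex (z : Site), up)
  rw [Prod.Lex.toLex_lt_toLex, Prod.Lex.toLex_le_toLex]
  have h : m.2 < dn ↔ m.2 ≤ up := by
    generalize m.2 = s
    revert s
    decide
  simp only [h]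

theorem mode_up_ne_mode_dn (z : box l) : mode z up ≠ mode z dn := fun h => by
  exact Fin.zero_ne_one (congrArg Prod.snd h)

/-- The operator which annihilates the pair at `z`. -/
noncomputable def pairKill (z : box l) : Algebra l := a z dn * a z up

theorem pairHop_eq (y z : box l) : pairHop y z = (pairKill y)ᴴ * pairKill z := by
  simp only [pairHop, pairKill, aStar, Matrix.conjTranspose_mul, mul_assoc]

theorem pairKill_apply (z : box l) (R S : Finset (Mode l)) : pairKill z R S =
    if mode z up ∈ S ∧ mode z dn ∈ S ∧ R = (S.erase (mode z up)).erase (mode z dn) then 1 else 0 := by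
  change ∑ T, annihilate (mode z dn) R T * annihilate (mode z up) T S = _
  rw [Finset.sum_eq_single (S.erase (mode z up))]
  · have hf : ((S.erase (mode z up)).filter (· < mode z dn)) = S.filter (· < mode z up) := by
      ext m
      rw [Finset.mem_filter, Finset.mem_filter, Finset.mem_erase, lt_mode_dn_iff,
        lt_iff_le_and_ne]
      tauto
    have h1 : mode z dn ∈ S.erase (mode z up) ↔ mode z dn ∈ S := by
      simp [Finset.mem_erase, (mode_up_ne_mode_dn z).symm]
    simp only [annihilate, hf, h1, and_true]
    by_cases hu : mode z up ∈ S <;>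
      by_cases hd : mode z dn ∈ S ∧ R = (S.erase (mode z up)).erase (mode z dn)
    · simp [hu, hd, ← mul_pow]
    · simp [hu, hd]
    · simp [hu]
    · simp [hu]
  · intro T _ hT
    simp [annihilate, hT]
  · simp

/-- The modes of the sites in `X`. -/
noncomputable def doubled (X : Finset (box l)) : Finset (Mode l) := Finset.univ.filter fun m => m.1 ∈ X

theorem mem_doubled {X : Finset (box l)} {m : Mode l} : m ∈ doubled X ↔ m.1 ∈ X := by
  simp [doubled]

theorem doubled_injective : Function.Injective (doubled (l := l)) := fun X Y h => by
  ext x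
  have := Finset.ext_iff.1 h (mode x up)
  rwa [mem_doubled, mem_doubled] at this

theorem doubled_erase (X : Finset (box l)) (z : box l) :
    ((doubled X).erase (mode z up)).erase (mode z dn) = doubled (X.erase z) := by
  ext m
  have hs : m.2 = up ∨ m.2 = dn := by
    generalize m.2 = s
    revert s
    decide
  have h1 : m = mode z up ↔ m.1 = z ∧ m.2 = up := Prod.ext_iff
  have h2 : m = mode z dn ↔ m.1 = z ∧ m.2 = dn := Prod.ext_iff
  simp only [Finset.mem_erase, mem_doubled, ne_eq, h1, h2]
  tauto

theorem pairKill_doubled (z : box l) (R : Finset (Mode l)) (X : Finset (box l)) :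
    pairKill z R (doubled X) = if z ∈ X ∧ R = doubled (X.erase z) then 1 else 0 := by
  rw [pairKill_apply, doubled_erase]
  simp only [mem_doubled, ← and_assoc]
  simp only [mode, and_self]

theorem pairHop_doubled (y z : box l) (X Y : Finset (box l)) :
    pairHop y z (doubled X) (doubled Y) =
      if y ∈ X ∧ z ∈ Y ∧ X.erase y = Y.erase z then 1 else 0 := by
  rw [pairHop_eq, Matrix.mul_apply, Finset.sum_eq_single (doubled (Y.erase z))]
  · simp only [Matrix.conjTranspose_apply, pairKill_doubled, doubled_injective.eq_iff, and_true]
    by_cases hy : y ∈ X <;> by_cases hz : z ∈ Y <;> simp [hy, hz, eq_comm]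
  · intro R _ hR
    simp [pairKill_doubled, hR]
  · simp

/-- The amplitude of the set `X` of doubly occupied sites in the product vector whose factor at
the site `x` is `u x |0⟩ + v x |↑↓⟩`. -/
noncomputable def amplitude (u v : box l → ℂ) (X : Finset (box l)) : ℂ :=
  (∏ x ∈ X, v x) * ∏ x ∈ Xᶜ, u x

theorem sum_star_amplitude_mul_self {u v : box l → ℂ}
    (huv : ∀ x, star (v x) * v x + star (u x) * u x = 1) :
    ∑ X, star (amplitude u v X) * amplitude u v X = 1 := by
  have h := Fintype.prod_add (fun x => star (v x) * v x) (fun x => star (u x) * u x)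
  rw [Finset.prod_congr rfl fun x _ => huv x, Finset.prod_const_one] at h
  rw [h]
  refine Finset.sum_congr rfl fun X _ => ?_
  rw [amplitude, star_mul', star_prod, star_prod, Finset.prod_mul_distrib,
    Finset.prod_mul_distrib]
  ring

/-- The product state whose factor at the site `x` is given by `u x |0⟩ + v x |↑↓⟩`. -/
noncomputable def pairState (u v : box l → ℂ)
    (huv : ∀ x, star (v x) * v x + star (u x) * u x = 1) : State l where
  toLinearMap :=
    { toFun := fun A => ∑ X, ∑ Y,
        star (amplitude u v X) * A (doubled X) (doubled Y) * amplitude u v Y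
      map_add' := fun A A' => by
        simp only [Matrix.add_apply, mul_add, add_mul, Finset.sum_add_distrib]
      map_smul' := fun c A => by
        simp only [Matrix.smul_apply, smul_eq_mul, Finset.mul_sum, RingHom.id_apply]
        refine Finset.sum_congr rfl fun X _ => Finset.sum_congr rfl fun Y _ => ?_
        ring }
  nonneg A := by
    change (0 : ℂ) ≤ ∑ X, ∑ Y, star (amplitude u v X) * (Aᴴ * A) (doubled X) (doubled Y) *
      amplitude u v Y
    rw [sum_star_mul_conjTranspose_mul_self]
    exact Finset.sum_nonneg fun T _ => star_mul_self_nonneg _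
  map_one := by
    change ∑ X, ∑ Y, star (amplitude u v X) * (1 : Algebra l) (doubled X) (doubled Y) *
      amplitude u v Y = 1
    simp only [Matrix.one_apply, doubled_injective.eq_iff]
    simpa using sum_star_amplitude_mul_self huv

theorem amplitude_insert (u v : box l → ℂ) {y z : box l} (hyz : y ≠ z) {W : Finset (box l)}
    (hW : W ⊆ {y, z}ᶜ) : amplitude u v (insert y W) =
      v y * u z * ((∏ x ∈ W, v x) * ∏ x ∈ {y, z}ᶜ \ W, u x) := by
  have hy : y ∉ W := fun h => by simpa using hW h
  have hz : z ∉ W := fun h => by simpa using hW h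
  have hc : (insert y W)ᶜ = insert z ({y, z}ᶜ \ W) := by
    ext x
    simp only [Finset.mem_compl, Finset.mem_insert, Finset.mem_sdiff, Finset.mem_singleton]
    by_cases hx : x = z
    · subst hx
      simp [hyz.symm, hz]
    · simp [hx]
  rw [amplitude, hc, Finset.prod_insert hy, Finset.prod_insert (by simp)]
  ring

/-- Only configurations that agree away from `y` and `z` contribute. Summing over the common part
`W` gives the product of the norms of the other factors, which is 1. -/
theorem pairState_pairHop {u v : box l → ℂ}
    (huv : ∀ x, star (v x) * v x + star (u x) * u x = 1) {y z : box l} (hyz : y ≠ z) :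
    (pairState u v huv).toLinearMap (pairHop y z) =
      star (v y) * u y * (star (u z) * v z) := by
  change ∑ X, ∑ Y, star (amplitude u v X) * pairHop y z (doubled X) (doubled Y) *
    amplitude u v Y = _
  have hsum : ∑ X, ∑ Y, star (amplitude u v X) * pairHop y z (doubled X) (doubled Y) *
      amplitude u v Y = ∑ W ∈ ({y, z}ᶜ : Finset (box l)).powerset,
        star (amplitude u v (insert y W)) * amplitude u v (insert z W) := by
    simp only [pairHop_doubled, mul_ite, ite_mul, mul_one, mul_zero, zero_mul]
    rw [← Finset.sum_product', ← Finset.sum_filter]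
    refine Finset.sum_bij' (fun p _ => p.1.erase y) (fun W _ => (insert y W, insert z W))
      ?_ ?_ ?_ ?_ ?_
    · rintro ⟨X, Y⟩ h
      simp only [Finset.mem_filter] at h
      rw [Finset.mem_powerset]
      intro x hx
      have hx' : x ∈ Y.erase z := h.2.2.2 ▸ hx
      simp [Finset.ne_of_mem_erase hx, Finset.ne_of_mem_erase hx']
    · intro W hW
      rw [Finset.mem_powerset] at hW
      have hy : y ∉ W := fun h => by simpa using hW h
      have hz : z ∉ W := fun h => by simpa using hW h
      simp [Finset.erase_insert hy, Finset.erase_insert hz]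
    · rintro ⟨X, Y⟩ h
      simp only [Finset.mem_filter] at h
      simp only [Prod.mk.injEq]
      exact ⟨Finset.insert_erase h.2.1, by rw [h.2.2.2, Finset.insert_erase h.2.2.1]⟩
    · intro W hW
      rw [Finset.mem_powerset] at hW
      exact Finset.erase_insert fun h => by simpa using hW h
    · rintro ⟨X, Y⟩ h
      simp only [Finset.mem_filter] at h
      simp only
      rw [Finset.insert_erase h.2.1, h.2.2.2, Finset.insert_erase h.2.2.1]
  have hprod := Finset.prod_add (fun x => star (v x) * v x) (fun x => star (u x) * u x)
    ({y, z}ᶜ : Finset (box l))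
  rw [Finset.prod_congr rfl fun x _ => huv x, Finset.prod_const_one] at hprod
  rw [hsum]
  conv_rhs => rw [← mul_one (star (v y) * u y * (star (u z) * v z)), hprod, Finset.mul_sum]
  refine Finset.sum_congr rfl fun W hW => ?_
  rw [Finset.mem_powerset] at hW
  have hW' : W ⊆ {z, y}ᶜ := by rwa [Finset.pair_comm]
  rw [amplitude_insert u v hyz hW, amplitude_insert u v hyz.symm hW', Finset.pair_comm z y]
  simp only [star_mul', star_prod, Finset.prod_mul_distrib]
  ring

/-- For disjoint sets of sites there is a state with a current from each site of the first set to
each site of the second set, and no other currents. -/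
theorem exists_state_current (s t : Finset (box l)) (hst : Disjoint s t) : ∃ σ : State l,
    ∀ (γ : ℝ) (y z : box l), y ≠ z → σ.expect (currentObservable γ y z) =
      γ / (box l).card * ((if y ∈ s ∧ z ∈ t then 1 else 0) - if z ∈ s ∧ y ∈ t then 1 else 0) := by
  set r : ℂ := (((√2)⁻¹ : ℝ) : ℂ) with hr
  have hr2 : r * r = 1 / 2 := by
    rw [hr, ← Complex.ofReal_mul, ← mul_inv, Real.mul_self_sqrt (by norm_num)]
    norm_num
  have hrs : star r = r := Complex.conj_ofReal _
  set u : box l → ℂ := fun x => if x ∈ s ∨ x ∈ t then r else 1 with hu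
  -- The relative phase `i` makes the hopping amplitude from `s` to `t` equal to `i / 4`, while it
  -- is real within each set, and zero if a site lies outside both.
  set v : box l → ℂ := fun x => if x ∈ s then r else if x ∈ t then Complex.I * r else 0 with hv
  have hI : star Complex.I = -Complex.I := Complex.conj_I
  have huv : ∀ x, star (v x) * v x + star (u x) * u x = 1 := by
    intro x
    by_cases hs : x ∈ s
    · simp only [hu, hv, hs, true_or, if_true, hrs, hr2]
      norm_num
    · by_cases ht : x ∈ t
      · simp only [hu, hv, hs, ht, or_true, if_true, if_false, star_mul', hrs, hI]
        linear_combination 2 * hr2 - r * r * Complex.I_mul_I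
      · simp [hu, hv, hs, ht]
  refine ⟨pairState u v huv, fun γ y z hyz => ?_⟩
  rw [State.expect_currentObservable, pairState_pairHop huv hyz]
  have hg : ∀ x, star (u x) * v x =
      if x ∈ s then (1 / 2 : ℂ) else if x ∈ t then Complex.I / 2 else 0 := by
    intro x
    by_cases hs : x ∈ s
    · simp only [hu, hv, hs, true_or, if_true, hrs, hr2]
    · by_cases ht : x ∈ t
      · simp only [hu, hv, hs, ht, or_true, if_true, if_false, hrs]
        linear_combination Complex.I * hr2
      · simp [hv, hs, ht]
  have hg' : ∀ x, star (v x) * u x =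
      if x ∈ s then (1 / 2 : ℂ) else if x ∈ t then -Complex.I / 2 else 0 := by
    intro x
    have h := congrArg star (hg x)
    rw [star_mul', star_star, mul_comm] at h
    rw [h]
    split_ifs
    · simp
    · simp
    · simp
  rw [hg, hg']
  have hd := Finset.disjoint_left.1 hst
  by_cases h1 : y ∈ s
  · have h2 := hd h1
    by_cases h3 : z ∈ s
    · have h4 := hd h3
      simp [h1, h2, h3, h4]
    · by_cases h4 : z ∈ t
      · simp [h1, h2, h3, h4]
        ring
      · simp [h1, h2, h3, h4]
  · by_cases h2 : y ∈ t
    · by_cases h3 : z ∈ s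
      · have h4 := hd h3
        simp [h1, h2, h3, h4]
        ring
      · by_cases h4 : z ∈ t
        · simp [h1, h2, h3, h4]
        · simp [h1, h2, h3, h4]
    · simp [h1, h2]

end PairStates


/-! ### Bounds on the free-energy density -/

section HamiltonianNorm

open scoped Matrix.Norms.L2Operator

theorem norm_ofReal_smul_sum_box_le {l : ℕ} (c : ℝ) {f : box l → Algebra l} {k : ℝ}
    (h : ∀ x, ‖f x‖ ≤ k) : ‖(c : ℂ) • ∑ x, f x‖ ≤ |c| * ((box l).card * k) := by
  rw [norm_smul, Complex.norm_real, Real.norm_eq_abs]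
  exact mul_le_mul_of_nonneg_left (norm_sum_box_le h) (abs_nonneg c)

theorem norm_pairHop_le {l : ℕ} (x y : box l) : ‖pairHop x y‖ ≤ 1 :=
  norm_mul_le_one (norm_mul_le_one (norm_mul_le_one (norm_aStar_le _ _) (norm_aStar_le _ _))
    (norm_a_le _ _)) (norm_a_le _ _)

theorem norm_hamiltonianT_le (μ lam γ : ℝ) (l : ℕ) :
    ‖hamiltonianT μ lam γ l‖ ≤ (box l).card * (2 * |μ| + 2 * |lam| + |γ|) := by
  have h1 : ‖(μ : ℂ) • ∑ x : box l, (num x up + num x dn)‖ ≤ |μ| * ((box l).card * 2) :=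
    norm_ofReal_smul_sum_box_le μ fun x =>
      (norm_add_le_of_le (norm_num_le x up) (norm_num_le x dn)).trans_eq (by norm_num)
  have h2 : ‖((2 * lam : ℝ) : ℂ) • ∑ x : box l, num x up * num x dn‖ ≤
      |2 * lam| * ((box l).card * 1) :=
    norm_ofReal_smul_sum_box_le _ fun x => norm_mul_le_one (norm_num_le x up) (norm_num_le x dn)
  have h3 : ‖((γ / (box l).card : ℝ) : ℂ) • ∑ x : box l, ∑ y : box l, pairHop x y‖ ≤
      |γ / (box l).card| * ((box l).card * ((box l).card * 1)) :=
    norm_ofReal_smul_sum_box_le _ fun x => norm_sum_box_le fun y => norm_pairHop_le x y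
  -- The mean-field factor `1 / |Λ|` turns the double sum into a quantity proportional to the
  -- volume; the empty box needs a separate case.
  have h4 : |γ / (box l).card| * ((box l).card * ((box l).card * 1)) = |γ| * (box l).card := by
    rcases eq_or_ne ((box l).card : ℝ) 0 with h | h
    · simp [h]
    · rw [abs_div, Nat.abs_cast]
      field_simp
  rw [h4] at h3
  rw [abs_mul, abs_two] at h2
  rw [hamiltonianT_eq]
  refine (norm_sub_le_of_le (norm_add_le_of_le ((norm_neg _).trans_le h1) h2) h3).trans_eq ?_
  ring

theorem norm_hamiltonianM_le (ϑ : ℝ) (B : Space → Space) {l : ℕ} {b : ℝ}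
    (hb : ∀ (x : box l) i, |cellField B l x i| ≤ b) :
    ‖hamiltonianM ϑ B l‖ ≤ (box l).card * (6 * |ϑ| * b) := by
  have key : ∀ (x : box l) (i : Fin 3) (P Q : Algebra l), ‖P‖ ≤ 1 → ‖Q‖ ≤ 1 →
      ‖(cellField B l x i : ℂ) • (P + Q)‖ ≤ b * 2 ∧
        ‖(cellField B l x i : ℂ) • (P - Q)‖ ≤ b * 2 := by
    intro x i P Q hP hQ
    have hb0 := (abs_nonneg _).trans (hb x i)
    constructor <;> rw [norm_smul, Complex.norm_real, Real.norm_eq_abs]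
    · exact mul_le_mul (hb x i) ((norm_add_le_of_le hP hQ).trans_eq (by norm_num))
        (norm_nonneg _) hb0
    · exact mul_le_mul (hb x i) ((norm_sub_le_of_le hP hQ).trans_eq (by norm_num))
        (norm_nonneg _) hb0
  have hflip : ∀ (x : box l) (s t : Spin), ‖aStar x s * a x t‖ ≤ 1 := fun x s t =>
    norm_mul_le_one (norm_aStar_le x s) (norm_a_le x t)
  have h1 := norm_ofReal_smul_sum_box_le ϑ fun x =>
    (key x 0 _ _ (hflip x up dn) (hflip x dn up)).1
  have h2 : ‖(Complex.I * (ϑ : ℂ)) • ∑ x : box l,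
      (cellField B l x 1 : ℂ) • (aStar x up * a x dn - aStar x dn * a x up)‖ ≤
        |ϑ| * ((box l).card * (b * 2)) := by
    rw [mul_smul, norm_smul, Complex.norm_I, one_mul]
    exact norm_ofReal_smul_sum_box_le ϑ fun x =>
      (key x 1 _ _ (hflip x up dn) (hflip x dn up)).2
  have h3 := norm_ofReal_smul_sum_box_le ϑ fun x =>
    (key x 2 _ _ (norm_num_le x up) (norm_num_le x dn)).2
  rw [hamiltonianM]
  refine (norm_sub_le_of_le (norm_add_le_of_le ((norm_neg _).trans_le h1) h2) h3).trans_eq ?_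
  ring

theorem abs_freeEnergyDensity_le (μ lam γ ϑ : ℝ) {β : ℝ} (hβ : 0 < β) (B : Space → Space)
    {l : ℕ} {b : ℝ} (hb0 : 0 ≤ b) (hb : ∀ (x : box l) i, |cellField B l x i| ≤ b) (ρ : State l) :
    |freeEnergyDensity μ lam γ ϑ β B ρ| ≤
      2 * |μ| + 2 * |lam| + |γ| + 6 * |ϑ| * b + β⁻¹ * Real.log 4 := by
  have hE : |ρ.expect (hamiltonian μ lam γ ϑ B l)| ≤
      (box l).card * (2 * |μ| + 2 * |lam| + |γ|) + (box l).card * (6 * |ϑ| * b) :=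
    (Complex.abs_re_le_norm _).trans <| (ρ.norm_map_le _).trans <|
      norm_add_le_of_le (norm_hamiltonianT_le μ lam γ l) (norm_hamiltonianM_le ϑ B hb)
  have hS : |β⁻¹ * entropy ρ| ≤ β⁻¹ * ((box l).card * Real.log 4) := by
    rw [abs_mul, abs_of_nonneg (entropy_nonneg ρ), abs_of_pos (inv_pos.2 hβ)]
    exact mul_le_mul_of_nonneg_left (entropy_le ρ) (inv_nonneg.2 hβ.le)
  have hlog : 0 ≤ Real.log 4 := Real.log_nonneg (by norm_num)
  rw [freeEnergyDensity, abs_mul, abs_inv, Nat.abs_cast]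
  refine (mul_le_mul_of_nonneg_left ((abs_sub _ _).trans (add_le_add hE hS))
    (by positivity)).trans ?_
  rcases eq_or_ne ((box l).card : ℝ) 0 with h | h
  · rw [h, inv_zero, zero_mul]
    positivity
  · refine le_of_eq ?_
    field_simp

end HamiltonianNorm

theorem bddBelow_freeEnergyDensity (μ lam γ ϑ : ℝ) {β : ℝ} (hβ : 0 < β) (B : Space → Space)
    (l : ℕ) : BddBelow (Set.range fun σ : State l => freeEnergyDensity μ lam γ ϑ β B σ) := by
  have hb : ∀ (x : box l) i,
      |cellField B l x i| ≤ ∑ x : box l, ∑ i, |cellField B l x i| := fun x i =>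
    (Finset.single_le_sum (f := fun i => |cellField B l x i|) (fun _ _ => abs_nonneg _)
      (Finset.mem_univ i)).trans
    (Finset.single_le_sum (f := fun x : box l => ∑ i, |cellField B l x i|)
      (fun _ _ => Finset.sum_nonneg fun _ _ => abs_nonneg _) (Finset.mem_univ x))
  have key := fun σ : State l => (abs_le.1 (abs_freeEnergyDensity_le μ lam γ ϑ hβ B
    (Finset.sum_nonneg fun _ _ => Finset.sum_nonneg fun _ _ => abs_nonneg _) hb σ)).1
  exact ⟨_, Set.forall_mem_range.2 key⟩

/-! ### The unit cube and cell averages of the induction -/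

theorem isClosed_cube : IsClosed cube := by
  have : cube = ⋂ i : Fin 3, (fun t : Space => t i) ⁻¹' Set.Icc (-(1 / 2) : ℝ) (1 / 2) := by
    ext t
    simp only [cube, Set.mem_ofPred_eq, Set.mem_iInter, Set.mem_preimage]
  rw [this]
  exact isClosed_iInter fun i => isClosed_Icc.preimage (by fun_prop)

theorem norm_le_of_forall_abs_le {t : Space} {c : ℝ} (h : ∀ i, |t i| ≤ c) : ‖t‖ ≤ 2 * c := by
  have hc : 0 ≤ c := (abs_nonneg _).trans (h 0)
  rw [EuclideanSpace.norm_eq]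
  refine Real.sqrt_le_iff.2 ⟨by positivity, ?_⟩
  have h2 : ∀ i, ‖t i‖ ^ 2 ≤ c ^ 2 := fun i => by
    rw [Real.norm_eq_abs]
    exact pow_le_pow_left₀ (abs_nonneg _) (h i) 2
  rw [Fin.sum_univ_three]
  nlinarith [h2 0, h2 1, h2 2]

theorem cube_subset_closedBall : cube ⊆ Metric.closedBall 0 1 := fun t ht => by
  rw [mem_closedBall_zero_iff]
  exact (norm_le_of_forall_abs_le fun i => abs_le.2 (ht i)).trans_eq (by norm_num)

theorem isCompact_cube : IsCompact cube :=
  (isCompact_closedBall (0 : Space) 1).of_isClosed_subset isClosed_cube cube_subset_closedBall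

/-- The cell averages of a square integrable field grow at most like the square root of the
volume. -/
theorem exists_abs_cellField_le {B : Space → Space} (hB : MemLp B 2 (volume.restrict cube)) :
    ∃ K : ℝ, 0 ≤ K ∧ ∀ (l : ℕ), 0 < l → ∀ (x : Site) (i : Fin 3),
      |cellField B l x i| ≤ K * (2 * (l : ℝ) * √(2 * (l : ℝ))) := by
  set G := cube.indicator B with hG
  have hGm : MemLp G 2 volume := (memLp_indicator_iff_restrict isClosed_cube.measurableSet).2 hB
  have hG2 : Integrable (fun y => ‖G y‖ ^ 2) volume :=
    (memLp_two_iff_integrable_sq_norm hGm.1).1 hGm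
  refine ⟨1 / 2 * ((∫ y, ‖G y‖ ^ 2) + volume.real cube), by positivity, fun l hl x i => ?_⟩
  set D : ℝ := 2 * (l : ℝ) with hD
  have hDpos : 0 < D := by positivity
  -- The integrand is bounded through `2 g ≤ s g² + s⁻¹`. Rescaling contributes `D³` to the integral
  -- of `g²`, and `s = D^(-3/2)` balances both terms at `D^(3/2)`.
  set s : ℝ := (D * √D)⁻¹ with hs
  have hspos : 0 < s := by positivity
  have hint : Integrable (fun y => ‖G (D⁻¹ • (x.toSpace + y))‖ ^ 2) volume :=
    (hG2.comp_smul (inv_ne_zero hDpos.ne')).comp_add_left x.toSpace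
  have hval : ∫ y, ‖G (D⁻¹ • (x.toSpace + y))‖ ^ 2 = D ^ 3 * ∫ y, ‖G y‖ ^ 2 := by
    rw [integral_add_left_eq_self (fun y => ‖G (D⁻¹ • y)‖ ^ 2) x.toSpace,
      Measure.integral_comp_inv_smul volume (fun y => ‖G y‖ ^ 2) D]
    simp [abs_of_pos hDpos]
  have hfin : IsFiniteMeasure (volume.restrict cube) :=
    ⟨by simpa using isCompact_cube.measure_lt_top⟩
  have hbound : Integrable (fun y => 1 / 2 * (s * ‖G (D⁻¹ • (x.toSpace + y))‖ ^ 2 + s⁻¹))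
      (volume.restrict cube) :=
    ((hint.restrict.const_mul s).add (integrable_const _)).const_mul _
  have hle : |cellField B l x i| ≤
      ∫ y in cube, 1 / 2 * (s * ‖G (D⁻¹ • (x.toSpace + y))‖ ^ 2 + s⁻¹) := by
    refine norm_integral_le_of_norm_le (G := ℝ) hbound (Eventually.of_forall fun y => ?_)
    refine (PiLp.norm_apply_le _ i).trans ?_
    set g := ‖G (D⁻¹ • (x.toSpace + y))‖
    have h1 : s * (g - s⁻¹) ^ 2 = s * g ^ 2 - 2 * g + s⁻¹ := by
      field_simp
      ring
    linarith [mul_nonneg hspos.le (sq_nonneg (g - s⁻¹))]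
  refine hle.trans ?_
  rw [integral_const_mul, integral_add (hint.restrict.const_mul s) (integrable_const _),
    integral_const_mul, integral_const]
  have h2 : ∫ y in cube, ‖G (D⁻¹ • (x.toSpace + y))‖ ^ 2 ≤ D ^ 3 * ∫ y, ‖G y‖ ^ 2 := by
    rw [← hval]
    exact setIntegral_le_integral hint (Eventually.of_forall fun y => by positivity)
  have h3 : s * D ^ 3 = D * √D := by
    rw [hs]
    have := Real.mul_self_sqrt hDpos.le
    field_simp
    nlinarith
  have h4 : s⁻¹ = D * √D := by rw [hs, inv_inv]
  have h5 := mul_le_mul_of_nonneg_left h2 hspos.le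
  rw [← mul_assoc, h3] at h5
  rw [h4, measureReal_restrict_apply_univ, smul_eq_mul]
  linarith

/-- Uniform bound on the free-energy densities of all states of a box. -/
theorem exists_abs_freeEnergyDensity_le (μ lam γ ϑ : ℝ) {β : ℝ} (hβ : 0 < β) {B : Space → Space}
    (hB : MemLp B 2 (volume.restrict cube)) :
    ∃ K : ℝ, 0 ≤ K ∧ ∀ (l : ℕ), 0 < l → ∀ ρ : State l, |freeEnergyDensity μ lam γ ϑ β B ρ| ≤
      K * (2 * (l : ℝ) * √(2 * (l : ℝ))) := by
  obtain ⟨K, hK, h⟩ := exists_abs_cellField_le hB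
  have hlog : 0 ≤ Real.log 4 := Real.log_nonneg (by norm_num)
  refine ⟨2 * |μ| + 2 * |lam| + |γ| + β⁻¹ * Real.log 4 + 6 * |ϑ| * K, by positivity,
    fun l hl ρ => ?_⟩
  have h1 := abs_freeEnergyDensity_le μ lam γ ϑ hβ B (l := l) (by positivity)
    (fun x i => h l hl x i) ρ
  have hl' : (1 : ℝ) ≤ l := by exact_mod_cast hl
  have h2 : 1 ≤ 2 * (l : ℝ) * √(2 * (l : ℝ)) := by
    have : 1 ≤ √(2 * (l : ℝ)) := Real.one_le_sqrt.2 (by linarith)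
    nlinarith
  have h3 : 0 ≤ 2 * |μ| + 2 * |lam| + |γ| + β⁻¹ * Real.log 4 := by positivity
  nlinarith [mul_le_mul_of_nonneg_left h2 h3]


/-! ### Elementary current profiles -/

/-- The current density between the points `p` and `q`. -/
noncomputable def bump (ξ : Space → ℝ) (p q t : Space) : Space :=
  (ξ (‖q - p‖⁻¹ • (t - (2⁻¹ : ℝ) • (p + q))) / ‖q - p‖ ^ 3) • (q - p)

theorem bump_swap (ξ : Space → ℝ) (p q t : Space) : bump ξ q p t = -bump ξ p q t := by
  rw [bump, bump, norm_sub_rev p q, add_comm q p, ← smul_neg, neg_sub]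

theorem bump_self (ξ : Space → ℝ) (p t : Space) : bump ξ p p t = 0 := by
  simp [bump]

/-- Two powers of `D` are lost: the profile is scale invariant, the cube of the distance gives `D⁻³`
and the direction vector gives `D`. -/
theorem bump_smul (ξ : Space → ℝ) {D : ℝ} (hD : 0 < D) (p q t : Space) :
    bump ξ (D • p) (D • q) (D • t) = (D ^ 2)⁻¹ • bump ξ p q t := by
  have h1 : ‖D • q - D • p‖ = D * ‖q - p‖ := by
    rw [← smul_sub, norm_smul, Real.norm_of_nonneg hD.le]
  have h2 : (D * ‖q - p‖)⁻¹ • (D • t - (2⁻¹ : ℝ) • (D • p + D • q)) =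
      ‖q - p‖⁻¹ • (t - (2⁻¹ : ℝ) • (p + q)) := by
    rw [← smul_add, smul_comm (2⁻¹ : ℝ) D, ← smul_sub, smul_smul, mul_inv, mul_right_comm,
      inv_mul_cancel₀ hD.ne', one_mul]
  rw [bump, bump, h1, h2, ← smul_sub, smul_smul, smul_smul]
  congr 1
  rcases eq_or_ne ‖q - p‖ 0 with h | h
  · simp [h]
  · field_simp

theorem rescaledCurrentDensity_eq (γ : ℝ) (ξ : Space → ℝ) {l : ℕ} (hl : 0 < l) (ρ : State l)
    (t : Space) : rescaledCurrentDensity γ ξ ρ t = (2 * (l : ℝ))⁻¹ • ∑ y : box l, ∑ z : box l,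
      ρ.expect (currentObservable γ y z) •
        bump ξ ((2 * (l : ℝ))⁻¹ • Site.toSpace y) ((2 * (l : ℝ))⁻¹ • Site.toSpace z) t := by
  have hD : (0 : ℝ) < 2 * (l : ℝ) := by positivity
  rw [rescaledCurrentDensity, currentDensity]
  set D : ℝ := 2 * (l : ℝ)
  simp only [Finset.smul_sum]
  refine Finset.sum_congr rfl fun y _ => Finset.sum_congr rfl fun z _ => ?_
  have h := bump_smul ξ hD (D⁻¹ • Site.toSpace y) (D⁻¹ • Site.toSpace z) t
  rw [smul_inv_smul₀ hD.ne', smul_inv_smul₀ hD.ne'] at h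
  have h' : bump ξ (D⁻¹ • Site.toSpace y) (D⁻¹ • Site.toSpace z) t =
      D ^ 2 • bump ξ (Site.toSpace y) (Site.toSpace z) (D • t) := by
    rw [h, smul_inv_smul₀ (by positivity)]
  split_ifs with hyz
  · subst hyz
    simp [bump_self]
  · rw [h', bump, smul_smul, smul_smul, smul_smul, smul_smul]
    congr 1
    field_simp

/-! ### Counting lattice sites -/

theorem card_box (l : ℕ) : ((box l).card : ℝ) = (2 * (l : ℝ)) ^ 3 := by
  rw [box, Fintype.card_piFinset]
  simp only [Int.card_Ico, Finset.prod_const, Finset.card_univ, Fintype.card_fin]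
  rw [show ((l : ℤ) - -l).toNat = 2 * l by omega]
  push_cast
  ring

/-- The sites of the box in a small cube around the rescaled point `p`. -/
noncomputable def sitesNear (l : ℕ) (p : Space) (κ : ℝ) : Finset (box l) :=
  Finset.univ.filter fun x => ∀ i, |((2 * (l : ℝ))⁻¹ • Site.toSpace x - p) i| ≤ κ

theorem le_card_sitesNear {l : ℕ} {p : Space} {κ : ℝ} (hp : ∀ i, |p i| + κ < 1 / 2)
    (hl : 1 ≤ 2 * (l : ℝ) * κ) : (2 * (l : ℝ) * κ) ^ 3 ≤ (sitesNear l p κ).card := by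
  set D : ℝ := 2 * (l : ℝ) with hDdef
  have hD : 0 < D := by
    rcases (Nat.cast_nonneg (α := ℝ) l).eq_or_lt with h | h
    · rw [hDdef, ← h] at hl
      norm_num at hl
    · positivity
  set I : Fin 3 → Finset ℤ := fun i => Finset.Icc ⌈D * (p i - κ)⌉ ⌊D * (p i + κ)⌋ with hI
  -- An interval of length `2 D κ` contains at least `2 D κ - 1` integers, and `1 ≤ D κ`.
  have hcard : ∀ i, D * κ ≤ (I i).card := by
    intro i
    rw [hI, Int.card_Icc]
    have h1 := Int.ceil_lt_add_one (D * (p i - κ))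
    have h2 := Int.lt_floor_add_one (D * (p i + κ))
    have h3 : ((⌊D * (p i + κ)⌋ + 1 - ⌈D * (p i - κ)⌉ : ℤ) : ℝ) ≤
        ((⌊D * (p i + κ)⌋ + 1 - ⌈D * (p i - κ)⌉).toNat : ℝ) := by
      exact_mod_cast Int.self_le_toNat _
    refine le_trans ?_ h3
    push_cast
    nlinarith
  have hsub : Fintype.piFinset I ⊆ (sitesNear l p κ).map (Function.Embedding.subtype _) := by
    intro x hx
    rw [Fintype.mem_piFinset] at hx
    have hx' : ∀ i, D * (p i - κ) ≤ x i ∧ (x i : ℝ) ≤ D * (p i + κ) := fun i => by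
      have := Finset.mem_Icc.1 (hx i)
      exact ⟨Int.ceil_le.1 this.1, Int.le_floor.1 this.2⟩
    have hbox : x ∈ box l := by
      rw [box, Fintype.mem_piFinset]
      intro i
      obtain ⟨h1, h2⟩ := hx' i
      have h3 := hp i
      have h4 := abs_le.1 (le_refl |p i|)
      rw [Finset.mem_Ico]
      constructor
      · have : (-(l : ℝ)) ≤ x i := by nlinarith
        exact_mod_cast this
      · have : (x i : ℝ) < l := by nlinarith
        exact_mod_cast this
    rw [Finset.mem_map]
    refine ⟨⟨x, hbox⟩, ?_, rfl⟩
    rw [sitesNear, Finset.mem_filter]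
    refine ⟨Finset.mem_univ _, fun i => ?_⟩
    obtain ⟨h1, h2⟩ := hx' i
    have h5 : ((D⁻¹ • Site.toSpace x - p) i) = D⁻¹ * x i - p i := rfl
    rw [h5, abs_le]
    have h6 : D⁻¹ * x i * D = x i := by field_simp
    constructor <;> nlinarith
  have hle := Finset.card_le_card hsub
  rw [Finset.card_map, Fintype.card_piFinset] at hle
  calc (D * κ) ^ 3 = ∏ _i : Fin 3, D * κ := by simp
    _ ≤ ∏ i, ((I i).card : ℝ) :=
      Finset.prod_le_prod (fun _ _ => by linarith) fun i _ => hcard i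
    _ ≤ _ := by exact_mod_cast hle

theorem IsCurrentProfile.exists_eq_zero {ξ : Space → ℝ} (hξ : IsCurrentProfile ξ) :
    ∃ R : ℝ, 0 < R ∧ ∀ t, R < ‖t‖ → ξ t = 0 := by
  obtain ⟨R, hR, h⟩ := hξ.compactSupport.isCompact.isBounded.subset_closedBall_lt 0 0
  refine ⟨R, hR, fun t ht => image_eq_zero_of_notMem_tsupport fun h' => ?_⟩
  have := mem_closedBall_zero_iff.1 (h h')
  linarith

/-- Currents between nearby points are uniformly close. -/
theorem eventually_norm_bump_sub_le {ξ : Space → ℝ} (hξ : IsCurrentProfile ξ) {p q : Space}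
    (hpq : p ≠ q) {η : ℝ} (hη : 0 < η) : ∀ᶠ P : Space × Space in 𝓝 (p, q),
      ∀ t, ‖bump ξ P.1 P.2 t - bump ξ p q t‖ ≤ η := by
  obtain ⟨R, hR, hξ0⟩ := hξ.exists_eq_zero
  set ρ : ℝ := ‖q - p‖ with hρ
  have hρpos : 0 < ρ := norm_pos_iff.2 (sub_ne_zero.2 hpq.symm)
  set c₀ : ℝ := ‖(2⁻¹ : ℝ) • (p + q)‖ with hc₀
  -- Pairs near `(p, q)` have length below `ρ + 1` and midpoint of norm below `c₀ + 1`, so their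
  -- profiles all vanish beyond radius `T`. Compactness of the ball gives uniformity inside.
  set T : ℝ := (ρ + 1) * R + (c₀ + 1) with hT
  set s : Set (Space × Space) := {P | P.1 ≠ P.2} with hs
  have hsopen : IsOpen s := isOpen_ne_fun continuous_fst continuous_snd
  have hzero : ∀ P : Space × Space, P.1 ≠ P.2 → ‖P.2 - P.1‖ < ρ + 1 →
      ‖(2⁻¹ : ℝ) • (P.1 + P.2)‖ < c₀ + 1 → ∀ t, T < ‖t‖ → bump ξ P.1 P.2 t = 0 := by
    intro P hP h1 h2 t ht
    have h3 : 0 < ‖P.2 - P.1‖ := norm_pos_iff.2 (sub_ne_zero.2 hP.symm)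
    rw [bump, hξ0, zero_div, zero_smul]
    rw [norm_smul, norm_inv, norm_norm, ← div_eq_inv_mul, lt_div_iff₀ h3]
    have h4 := norm_sub_norm_le t ((2⁻¹ : ℝ) • (P.1 + P.2))
    nlinarith
  have hcont : ContinuousOn (Function.uncurry fun (P : Space × Space) t => bump ξ P.1 P.2 t)
      (s ×ˢ Metric.closedBall 0 T) := by
    have hne : ∀ x ∈ s ×ˢ Metric.closedBall (0 : Space) T, ‖x.1.2 - x.1.1‖ ≠ 0 := fun x hx =>
      norm_ne_zero_iff.2 (sub_ne_zero.2 (Ne.symm hx.1))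
    have hn : ContinuousOn (fun x : (Space × Space) × Space => ‖x.1.2 - x.1.1‖)
        (s ×ˢ Metric.closedBall 0 T) := Continuous.continuousOn (by fun_prop)
    refine ContinuousOn.smul (ContinuousOn.div ?_ (hn.pow 3) fun x hx => pow_ne_zero 3 (hne x hx))
      (Continuous.continuousOn (by fun_prop))
    refine hξ.smooth.continuous.comp_continuousOn ?_
    exact (hn.inv₀ hne).smul (Continuous.continuousOn (by fun_prop))
  obtain ⟨v, hv, h⟩ := (isCompact_closedBall (0 : Space) T).mem_uniformity_of_prod hcont
    (q := (p, q)) hpq (Metric.dist_mem_uniformity hη)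
  rw [hsopen.nhdsWithin_eq hpq] at hv
  have e1 : ∀ᶠ P : Space × Space in 𝓝 (p, q), ‖P.2 - P.1‖ < ρ + 1 :=
    ContinuousAt.eventually_lt (f := fun P : Space × Space => ‖P.2 - P.1‖) (by fun_prop)
      continuousAt_const (by simp [hρ])
  have e2 : ∀ᶠ P : Space × Space in 𝓝 (p, q), ‖(2⁻¹ : ℝ) • (P.1 + P.2)‖ < c₀ + 1 :=
    ContinuousAt.eventually_lt (f := fun P : Space × Space => ‖(2⁻¹ : ℝ) • (P.1 + P.2)‖)
      (by fun_prop) continuousAt_const (by simp [hc₀])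
  filter_upwards [hv, e1, e2, hsopen.mem_nhds hpq] with P hP h1 h2 h3 t
  rcases le_or_gt ‖t‖ T with ht | ht
  · have := h P hP t (mem_closedBall_zero_iff.2 ht)
    rw [← dist_eq_norm]
    exact le_of_lt this
  · rw [hzero P h3 h1 h2 t ht, hzero (p, q) hpq (by simp [hρ]) (by simp [hc₀]) t ht, sub_zero,
      norm_zero]
    exact hη.le

/-! ### Limits of currents -/

/-- The vector fields which are uniform limits of rescaled current densities, up to factors which
decay like the inverse square of the side length of the box. -/
def IsCurrentLimit (γ : ℝ) (ξ : Space → ℝ) (J : Space → Space) : Prop :=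
  ∀ η : ℝ, 0 < η → ∃ C : ℝ, ∀ᶠ l : ℕ in atTop, ∃ w : ℝ, 0 ≤ w ∧ w ≤ C ∧ ∃ σ : State l,
    ∀ t, ‖(w / (2 * (l : ℝ)) ^ 2) • rescaledCurrentDensity γ ξ σ t - J t‖ ≤ η

section CurrentLimits

variable {γ : ℝ} {ξ : Space → ℝ}

theorem IsCurrentLimit.add {J J' : Space → Space} (h : IsCurrentLimit γ ξ J)
    (h' : IsCurrentLimit γ ξ J') : IsCurrentLimit γ ξ (fun t => J t + J' t) := by
  intro η hη
  obtain ⟨C, hC⟩ := h (η / 2) (by positivity)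
  obtain ⟨C', hC'⟩ := h' (η / 2) (by positivity)
  refine ⟨C + C', ?_⟩
  filter_upwards [hC, hC'] with l h1 h2
  obtain ⟨w, hw0, hw, σ, hσ⟩ := h1
  obtain ⟨w', hw0', hw', σ', hσ'⟩ := h2
  refine ⟨w + w', by positivity, by linarith, ?_⟩
  -- Mix in proportion to the weights; if both vanish, any state serves.
  obtain ⟨τ, hτ⟩ : ∃ τ : State l, ∀ t, (w + w') • rescaledCurrentDensity γ ξ τ t =
      w • rescaledCurrentDensity γ ξ σ t + w' • rescaledCurrentDensity γ ξ σ' t := by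
    rcases (add_nonneg hw0 hw0').eq_or_lt with hs | hs
    · have e1 : w = 0 := by linarith
      have e2 : w' = 0 := by linarith
      exact ⟨σ, fun t => by simp [e1, e2]⟩
    · refine ⟨σ.mix σ' (w / (w + w')) (w' / (w + w')) (by positivity) (by positivity)
        (by field_simp), fun t => ?_⟩
      rw [rescaledCurrentDensity_mix, smul_add, smul_smul, smul_smul, mul_div_cancel₀ _ hs.ne',
        mul_div_cancel₀ _ hs.ne']
  refine ⟨τ, fun t => ?_⟩
  have e : ((w + w') / (2 * (l : ℝ)) ^ 2) • rescaledCurrentDensity γ ξ τ t - (J t + J' t) =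
      ((w / (2 * (l : ℝ)) ^ 2) • rescaledCurrentDensity γ ξ σ t - J t) +
      ((w' / (2 * (l : ℝ)) ^ 2) • rescaledCurrentDensity γ ξ σ' t - J' t) := by
    simp only [div_eq_inv_mul, mul_smul]
    rw [hτ, smul_add]
    abel
  rw [e]
  exact (norm_add_le_of_le (hσ t) (hσ' t)).trans_eq (by ring)

theorem IsCurrentLimit.smul {J : Space → Space} (h : IsCurrentLimit γ ξ J) {c : ℝ}
    (hc : 0 ≤ c) : IsCurrentLimit γ ξ (fun t => c • J t) := by
  intro η hη
  obtain ⟨C, hC⟩ := h (η / (c + 1)) (by positivity)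
  refine ⟨c * C, ?_⟩
  filter_upwards [hC] with l h1
  obtain ⟨w, hw0, hw, σ, hσ⟩ := h1
  refine ⟨c * w, by positivity, mul_le_mul_of_nonneg_left hw hc, σ, fun t => ?_⟩
  rw [mul_div_assoc, mul_smul, ← smul_sub, norm_smul, Real.norm_of_nonneg hc]
  refine (mul_le_mul_of_nonneg_left (hσ t) hc).trans ?_
  rw [mul_div_assoc', div_le_iff₀ (by positivity)]
  nlinarith

theorem isCurrentLimit_of_forall {J : Space → Space}
    (h : ∀ η : ℝ, 0 < η → ∃ J' : Space → Space, IsCurrentLimit γ ξ J' ∧ ∀ t, ‖J' t - J t‖ ≤ η) :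
    IsCurrentLimit γ ξ J := by
  intro η hη
  obtain ⟨J', h1, h2⟩ := h (η / 2) (by positivity)
  obtain ⟨C, hC⟩ := h1 (η / 2) (by positivity)
  refine ⟨C, ?_⟩
  filter_upwards [hC] with l h3
  obtain ⟨w, hw0, hw, σ, hσ⟩ := h3
  refine ⟨w, hw0, hw, σ, fun t => ?_⟩
  rw [← sub_add_sub_cancel _ (J' t)]
  exact (norm_add_le_of_le (hσ t) (h2 t)).trans_eq (by ring)

/-- The factor 2 counts both orders of each pair of sites: the observable and the profile both
change sign under exchange, so their contributions agree. -/
theorem exists_state_rescaledCurrentDensity {l : ℕ} (hl : 0 < l) (s s' : Finset (box l))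
    (hs : Disjoint s s') : ∃ σ : State l, ∀ t, rescaledCurrentDensity γ ξ σ t =
      (2 * γ / (2 * (l : ℝ)) ^ 4) • ∑ y ∈ s, ∑ z ∈ s',
        bump ξ ((2 * (l : ℝ))⁻¹ • Site.toSpace y) ((2 * (l : ℝ))⁻¹ • Site.toSpace z) t := by
  obtain ⟨σ, hσ⟩ := exists_state_current s s' hs
  refine ⟨σ, fun t => ?_⟩
  have hD : (0 : ℝ) < 2 * (l : ℝ) := by positivity
  rw [rescaledCurrentDensity_eq γ ξ hl]
  set b : box l → box l → Space := fun y z =>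
    bump ξ ((2 * (l : ℝ))⁻¹ • Site.toSpace y) ((2 * (l : ℝ))⁻¹ • Site.toSpace z) t with hb
  have hsum : ∀ u u' : Finset (box l), ∑ y ∈ u, ∑ z ∈ u', b y z =
      ∑ y, ∑ z, if y ∈ u ∧ z ∈ u' then b y z else 0 := by
    intro u u'
    simp only [ite_and, Finset.sum_ite_irrel, Finset.sum_const_zero, Finset.sum_ite_mem,
      Finset.univ_inter]
  have hswap : ∑ y ∈ s', ∑ z ∈ s, b y z = -∑ y ∈ s, ∑ z ∈ s', b y z := by
    rw [Finset.sum_comm, ← Finset.sum_neg_distrib]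
    refine Finset.sum_congr rfl fun y _ => ?_
    rw [← Finset.sum_neg_distrib]
    exact Finset.sum_congr rfl fun z _ => bump_swap _ _ _ _
  have hterm : ∀ y z : box l, σ.expect (currentObservable γ y z) • b y z =
      (γ / (box l).card) • ((if y ∈ s ∧ z ∈ s' then b y z else 0) -
        if y ∈ s' ∧ z ∈ s then b y z else 0) := by
    intro y z
    rcases eq_or_ne y z with rfl | hyz
    · simp [hb, bump_self]
    · rw [hσ γ y z hyz, mul_smul, sub_smul, ite_smul, ite_smul, one_smul, zero_smul]
      simp only [and_comm (a := z ∈ s)]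
  have e1 : ∑ y, ∑ z, σ.expect (currentObservable γ y z) • b y z =
      (γ / (box l).card) • (2 : ℝ) • ∑ y ∈ s, ∑ z ∈ s', b y z := by
    simp only [hterm, ← Finset.smul_sum, Finset.sum_sub_distrib]
    rw [← hsum, ← hsum, hswap, sub_neg_eq_add, two_smul]
  rw [e1, card_box, smul_smul, smul_smul]
  congr 1
  field_simp

theorem isCurrentLimit_bump (hγ : 0 < γ) (hξ : IsCurrentProfile ξ) {p q : Space} (hpq : p ≠ q)
    (hp : ∀ i, |p i| < 1 / 2) (hq : ∀ i, |q i| < 1 / 2) : IsCurrentLimit γ ξ (bump ξ p q) := by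
  intro η hη
  have hev := eventually_norm_bump_sub_le hξ hpq hη
  have hne : ∀ᶠ P : Space × Space in 𝓝 (p, q), P.1 ≠ P.2 :=
    (isOpen_ne_fun continuous_fst continuous_snd).mem_nhds hpq
  obtain ⟨ε, hε, hball⟩ := Metric.eventually_nhds_iff.1 (hev.and hne)
  obtain ⟨κ, hκ, hκε, hκp, hκq⟩ : ∃ κ : ℝ, 0 < κ ∧ 2 * κ < ε ∧ (∀ i, |p i| + κ < 1 / 2) ∧
      ∀ i, |q i| + κ < 1 / 2 := by
    have h1 : ∀ᶠ κ : ℝ in 𝓝[>] 0, 2 * κ < ε := nhdsWithin_le_nhds <|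
      ContinuousAt.eventually_lt (by fun_prop) continuousAt_const (by simpa using hε)
    have h2 : ∀ u : Space, (∀ i, |u i| < 1 / 2) → ∀ᶠ κ : ℝ in 𝓝[>] 0, ∀ i, |u i| + κ < 1 / 2 :=
      fun u hu => eventually_all.2 fun i => nhdsWithin_le_nhds <|
        ContinuousAt.eventually_lt (by fun_prop) continuousAt_const (by simpa using hu i)
    obtain ⟨κ, h3, h4, h5, h6⟩ :=
      (h1.and ((h2 p hp).and ((h2 q hq).and self_mem_nhdsWithin))).exists
    exact ⟨κ, h6, h3, h4, h5⟩
  refine ⟨(2 * γ * κ ^ 6)⁻¹, ?_⟩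
  have hlarge : ∀ᶠ l : ℕ in atTop, 1 ≤ 2 * (l : ℝ) * κ := by
    have : Tendsto (fun l : ℕ => 2 * (l : ℝ) * κ) atTop atTop :=
      (tendsto_natCast_atTop_atTop.const_mul_atTop (by norm_num)).atTop_mul_const hκ
    exact this.eventually_ge_atTop 1
  filter_upwards [hlarge, eventually_gt_atTop 0] with l hl hl0
  set D : ℝ := 2 * (l : ℝ) with hDdef
  have hD : 0 < D := by positivity
  set s := sitesNear l p κ
  set s' := sitesNear l q κ
  have hmem : ∀ {u : Space} {x : box l}, x ∈ sitesNear l u κ →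
      dist (D⁻¹ • Site.toSpace x) u < ε := fun {u x} hx => by
    rw [dist_eq_norm]
    exact (norm_le_of_forall_abs_le (Finset.mem_filter.1 hx).2).trans_lt hκε
  have hclose : ∀ y ∈ s, ∀ z ∈ s', (∀ t, ‖bump ξ (D⁻¹ • Site.toSpace y) (D⁻¹ • Site.toSpace z) t
      - bump ξ p q t‖ ≤ η) ∧ D⁻¹ • Site.toSpace y ≠ D⁻¹ • Site.toSpace z := fun y hy z hz =>
    hball (y := (D⁻¹ • Site.toSpace y, D⁻¹ • Site.toSpace z))
      (by rw [Prod.dist_eq]; exact max_lt (hmem hy) (hmem hz))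
  have hdisj : Disjoint s s' := Finset.disjoint_left.2 fun y hy hy' =>
    (hclose y hy y hy').2 rfl
  obtain ⟨σ, hσ⟩ := exists_state_rescaledCurrentDensity (γ := γ) (ξ := ξ) hl0 s s' hdisj
  have hcs : (D * κ) ^ 3 ≤ (s.card : ℝ) := le_card_sitesNear hκp hl
  have hcs' : (D * κ) ^ 3 ≤ (s'.card : ℝ) := le_card_sitesNear hκq hl
  have hDκ : 0 < (D * κ) ^ 3 := by positivity
  have hs0 : (0 : ℝ) < s.card := hDκ.trans_le hcs
  have hs0' : (0 : ℝ) < s'.card := hDκ.trans_le hcs'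
  -- With this weight the rescaled current is the plain average of the profiles over `s × s'`. The
  -- site counts keep it bounded independently of `l`.
  refine ⟨D ^ 6 / (2 * γ * (s.card * s'.card)), by positivity, ?_, σ, fun t => ?_⟩
  · have h1 : (D * κ) ^ 3 * (D * κ) ^ 3 ≤ (s.card : ℝ) * s'.card :=
      mul_le_mul hcs hcs' hDκ.le hs0.le
    rw [div_le_iff₀ (by positivity), ← div_eq_inv_mul, le_div_iff₀ (by positivity)]
    have h2 : 0 < 2 * γ := by positivity
    nlinarith [mul_le_mul_of_nonneg_left h1 h2.le]
  · have e : (D ^ 6 / (2 * γ * (s.card * s'.card)) / D ^ 2) • rescaledCurrentDensity γ ξ σ t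
        - bump ξ p q t = ((s.card : ℝ) * s'.card)⁻¹ • ∑ y ∈ s, ∑ z ∈ s',
          (bump ξ (D⁻¹ • Site.toSpace y) (D⁻¹ • Site.toSpace z) t - bump ξ p q t) := by
      rw [hσ, ← hDdef, smul_smul]
      simp only [Finset.sum_sub_distrib, Finset.sum_const, smul_sub]
      congr 1
      · congr 1
        field_simp
      · rw [← Nat.cast_smul_eq_nsmul ℝ, ← Nat.cast_smul_eq_nsmul ℝ, smul_smul, smul_smul, mul_assoc,
          inv_mul_cancel₀ (mul_pos hs0 hs0').ne', one_smul]
    rw [e, norm_smul, norm_inv, Real.norm_of_nonneg (by positivity), inv_mul_le_iff₀ (by positivity)]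
    refine (norm_sum_le_of_le _ fun y hy => norm_sum_le_of_le _ fun z hz =>
      (hclose y hy z hz).1 t).trans_eq ?_
    simp only [Finset.sum_const, nsmul_eq_mul]
    ring

theorem isCurrentLimit_kernel (hγ : 0 < γ) (hξ : IsCurrentProfile ξ) {r : ℝ} (hr : 0 < r)
    {c : Space} (hc : ∀ i, |c i| ≤ 1 / 2 - r) (V : Space) :
    IsCurrentLimit γ ξ (fun t => ((r ^ 3)⁻¹ * ξ (r⁻¹ • (t - c))) • V) := by
  have key : ∀ W : Space, W ≠ 0 →
      IsCurrentLimit γ ξ (fun t => ((r ^ 3)⁻¹ * ξ (r⁻¹ • (t - c))) • W) := by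
    intro W hW
    have hWn : 0 < ‖W‖ := norm_pos_iff.2 hW
    -- The segment from `c - d` to `c + d` has midpoint `c`, length `r` and direction `W`. Its
    -- half-length `r / 2` keeps both endpoints strictly inside the cube.
    set d : Space := (r / 2 / ‖W‖) • W with hd
    have hdn : ‖d‖ = r / 2 := by
      rw [hd, norm_smul, Real.norm_of_nonneg (by positivity)]
      field_simp
    have hd2 : (c + d) - (c - d) = (r / ‖W‖) • W := by
      rw [hd, add_sub_sub_cancel, ← add_smul]
      congr 1
      ring
    have hn : ‖(c + d) - (c - d)‖ = r := by
      rw [hd2, norm_smul, Real.norm_of_nonneg (by positivity)]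
      field_simp
    have hi : ∀ i, |d i| ≤ r / 2 := fun i => hdn ▸ PiLp.norm_apply_le d i
    have h := (isCurrentLimit_bump hγ hξ (p := c - d) (q := c + d)
      (fun h => by rw [h, sub_self, norm_zero] at hn; exact hr.ne hn)
      (fun i => by
        have h1 := abs_sub (c i) (d i)
        have h2 := hi i
        have h3 := hc i
        change |c i - d i| < _
        linarith)
      (fun i => by
        have h1 := abs_add_le (c i) (d i)
        have h2 := hi i
        have h3 := hc i
        change |c i + d i| < _
        linarith)).smul (c := ‖W‖ / r) (by positivity)
    convert h using 2 with t
    have hm : (2⁻¹ : ℝ) • ((c - d) + (c + d)) = c := by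
      rw [sub_add_add_cancel, ← two_smul ℝ c, smul_smul]
      norm_num
    rw [bump, hn, hm, hd2, smul_smul, smul_smul]
    congr 1
    field_simp
  by_cases hV : V = 0
  · have h := (key (EuclideanSpace.single 0 1) (by simp)).smul le_rfl
    simpa [hV] using h
  · exact key V hV

end CurrentLimits


/-! ### All continuous fields which vanish outside the cube are limits of currents -/

section Approximation

variable {γ : ℝ} {ξ : Space → ℝ}

open scoped BoundedContinuousFunction

theorem convex_isCurrentLimit : Convex ℝ {F : Space →ᵇ Space | IsCurrentLimit γ ξ F} :=
  fun _ hF _ hG _ _ ha hb _ => (IsCurrentLimit.smul hF ha).add (IsCurrentLimit.smul hG hb)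

theorem isClosed_isCurrentLimit : IsClosed {F : Space →ᵇ Space | IsCurrentLimit γ ξ F} := by
  refine isClosed_of_closure_subset fun F hF => isCurrentLimit_of_forall fun η hη => ?_
  obtain ⟨G, hG, hd⟩ := Metric.mem_closure_iff.1 hF η hη
  refine ⟨G, hG, fun t => ?_⟩
  rw [← dist_eq_norm, dist_comm]
  exact (BoundedContinuousFunction.dist_coe_le_dist t).trans hd.le

/-- Set integrals of current limits are current limits. -/
theorem isCurrentLimit_setIntegral {s : Set Space} (h0 : volume s ≠ 0) (hs : volume s ≠ ⊤)
    {F : Space → Space →ᵇ Space} (hF : ∀ c, IsCurrentLimit γ ξ (F c))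
    (hint : IntegrableOn F s) : IsCurrentLimit γ ξ (∫ c in s, F c : Space →ᵇ Space) := by
  -- An average stays in a closed convex set; the volume factor is restored by the cone property.
  have h : IsCurrentLimit γ ξ (⨍ c in s, F c : Space →ᵇ Space) :=
    convex_isCurrentLimit.set_average_mem isClosed_isCurrentLimit h0 hs
      (Eventually.of_forall hF) hint
  have h2 := h.smul (c := volume.real s) measureReal_nonneg
  rw [setAverage_eq] at h2
  convert h2 using 2 with t
  have h3 : volume.real s ≠ 0 := (measureReal_ne_zero_iff hs).2 h0
  rw [BoundedContinuousFunction.coe_smul, smul_inv_smul₀ h3]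

/-- The rescaled profile. -/
noncomputable def scaled (ξ : Space → ℝ) (r : ℝ) (t : Space) : ℝ := (r ^ 3)⁻¹ * ξ (r⁻¹ • t)

theorem continuous_scaled (hξ : IsCurrentProfile ξ) (r : ℝ) : Continuous (scaled ξ r) := by
  have := hξ.smooth.continuous
  unfold scaled
  fun_prop

theorem integral_scaled (hξ : IsCurrentProfile ξ) {r : ℝ} (hr : 0 < r) :
    ∫ t, scaled ξ r t = 1 := by
  simp only [scaled]
  rw [integral_const_mul, Measure.integral_comp_inv_smul volume ξ r, hξ.integral_eq_one]
  simp only [finrank_euclideanSpace, Fintype.card_fin, smul_eq_mul, mul_one]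
  rw [abs_of_pos (by positivity), inv_mul_cancel₀ (by positivity)]

theorem isCurrentLimit_scaled_smul (hγ : 0 < γ) (hξ : IsCurrentProfile ξ) {r : ℝ} (hr : 0 < r)
    {c : Space} (hc : ∀ i, |c i| ≤ 1 / 2 - r) (V : Space) :
    IsCurrentLimit γ ξ (fun t => scaled ξ r (t - c) • V) :=
  isCurrentLimit_kernel hγ hξ hr hc V

/-- The convolution kernel with values in bounded continuous functions. -/
theorem exists_continuous_kernel (hξ : IsCurrentProfile ξ) {r : ℝ} (hr : 0 < r)
    {J : Space → Space} (hJ : Continuous J) (hJ0 : ∀ t, t ∉ cube → J t = 0) :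
    ∃ F : Space → Space →ᵇ Space, Continuous F ∧ ∀ c t, F c t = scaled ξ r (t - c) • J c := by
  obtain ⟨R, hR, hξ0⟩ := hξ.exists_eq_zero
  set f : Space × Space → Space := fun x => scaled ξ r (x.2 - x.1) • J x.1 with hf
  have hcont : Continuous f := by
    have := continuous_scaled hξ r
    fun_prop
  have hsupp : HasCompactSupport f := by
    refine HasCompactSupport.intro (isCompact_cube.prod (isCompact_closedBall 0 (r * R + 1)))
      fun x hx => ?_
    by_cases h1 : x.1 ∈ cube
    · have h2 : r * R + 1 < ‖x.2‖ := by
        by_contra h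
        exact hx ⟨h1, mem_closedBall_zero_iff.2 (not_lt.1 h)⟩
      have h3 : ‖x.1‖ ≤ 1 := mem_closedBall_zero_iff.1 (cube_subset_closedBall h1)
      have h4 := norm_sub_norm_le x.2 x.1
      rw [hf]
      simp only [scaled]
      rw [hξ0, mul_zero, zero_smul]
      rw [norm_smul, norm_inv, Real.norm_of_nonneg hr.le, ← div_eq_inv_mul, lt_div_iff₀ hr]
      linarith
    · rw [hf]
      simp only [hJ0 _ h1, smul_zero]
  obtain ⟨C, hC⟩ := hsupp.exists_bound_of_continuous hcont
  -- Joint uniform continuity yields continuity of `c ↦ F c` in the supremum norm.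
  have hunif := hsupp.uniformContinuous_of_continuous hcont
  refine ⟨fun c => BoundedContinuousFunction.ofNormedAddCommGroup (fun t => f (c, t))
    (by fun_prop) C fun t => hC _, ?_, fun c t => rfl⟩
  rw [Metric.continuous_iff]
  intro c ε hε
  obtain ⟨δ, hδ, h⟩ := Metric.uniformContinuous_iff.1 hunif (ε / 2) (by positivity)
  refine ⟨δ, hδ, fun c' hc' => lt_of_le_of_lt ?_ (half_lt_self hε)⟩
  refine (BoundedContinuousFunction.dist_le (by positivity)).2 fun t => le_of_lt ?_
  exact h (by simpa [Prod.dist_eq, hδ] using hc')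

/-- The rescaled profile is a nonnegative approximate identity: its mass is 1 and its support has
radius `r R`, so only values of `g` near `t` count. -/
theorem norm_integral_scaled_smul_sub_le (hξ : IsCurrentProfile ξ) {R : ℝ}
    (hξ0 : ∀ t, R < ‖t‖ → ξ t = 0) {r : ℝ} (hr : 0 < r) {g : Space → Space} {t v : Space} {η : ℝ}
    (hint : Integrable fun c => scaled ξ r (t - c) • g c)
    (hg : ∀ c, dist c t ≤ r * R → ‖g c - v‖ ≤ η) :
    ‖(∫ c, scaled ξ r (t - c) • g c) - v‖ ≤ η := by
  have hψ : Continuous fun c => scaled ξ r (t - c) := by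
    have := continuous_scaled hξ r
    fun_prop
  have hψ0 : ∀ c, r * R < dist c t → scaled ξ r (t - c) = 0 := by
    intro c hc
    rw [scaled, hξ0, mul_zero]
    rw [norm_smul, norm_inv, Real.norm_of_nonneg hr.le, ← div_eq_inv_mul, lt_div_iff₀ hr,
      ← dist_eq_norm, dist_comm, mul_comm]
    exact hc
  have hψnn : ∀ c, 0 ≤ scaled ξ r (t - c) := fun c =>
    mul_nonneg (by positivity) (hξ.nonneg _)
  have hψsupp : HasCompactSupport fun c => scaled ξ r (t - c) :=
    HasCompactSupport.intro (isCompact_closedBall t (r * R)) fun c hc =>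
      hψ0 c (not_le.1 fun h => hc (Metric.mem_closedBall.2 h))
  have hψint : Integrable (fun c => scaled ξ r (t - c)) :=
    hψ.integrable_of_hasCompactSupport hψsupp
  have hψone : ∫ c, scaled ξ r (t - c) = 1 := by
    rw [integral_sub_left_eq_self (scaled ξ r) volume t, integral_scaled hξ hr]
  have hdiff : (∫ c, scaled ξ r (t - c) • g c) - v = ∫ c, scaled ξ r (t - c) • (g c - v) := by
    simp only [smul_sub]
    rw [integral_sub hint (hψint.smul_const _), integral_smul_const, hψone, one_smul]
  rw [hdiff]
  calc _ ≤ ∫ c, scaled ξ r (t - c) * η := by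
        refine norm_integral_le_of_norm_le (hψint.mul_const _) (Eventually.of_forall fun c => ?_)
        rw [norm_smul, Real.norm_of_nonneg (hψnn c)]
        rcases lt_or_ge (r * R) (dist c t) with hct | hct
        · rw [hψ0 c hct, zero_mul, zero_mul]
        · exact mul_le_mul_of_nonneg_left (hg c hct) (hψnn c)
    _ = η := by rw [integral_mul_const, hψone, one_mul]

/-- The cube without a boundary layer of width `r`. -/
def innerCube (r : ℝ) : Set Space := {c | ∀ i, |c i| ≤ 1 / 2 - r}

theorem measurableSet_innerCube (r : ℝ) : MeasurableSet (innerCube r) := by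
  have : innerCube r = ⋂ i : Fin 3, {c : Space | |c i| ≤ 1 / 2 - r} := by
    ext c
    simp only [innerCube, Set.mem_ofPred_eq, Set.mem_iInter]
  rw [this]
  exact (isClosed_iInter fun i => isClosed_le (by fun_prop) continuous_const).measurableSet

theorem exists_dist_eq_of_notMem_innerCube {r : ℝ} (hr : 0 < r) {c : Space}
    (hc : c ∉ innerCube r) : ∃ c' ∉ cube, dist c c' = r := by
  obtain ⟨i, hi⟩ : ∃ i, 1 / 2 - r < |c i| := by
    by_contra! h
    exact hc h
  obtain ⟨e, he, hei⟩ : ∃ e : ℝ, |e| = 1 ∧ |c i + e * r| = |c i| + r := by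
    rcases le_total 0 (c i) with h | h
    · exact ⟨1, by norm_num, by rw [one_mul, abs_of_nonneg h, abs_of_nonneg (by positivity)]⟩
    · exact ⟨-1, by norm_num, by
        rw [abs_of_nonpos h, abs_of_nonpos (by linarith)]
        ring⟩
  refine ⟨c + EuclideanSpace.single i (e * r), fun h => ?_, ?_⟩
  · have h1 := abs_le.2 (h i)
    have h2 : (c + EuclideanSpace.single i (e * r)) i = c i + e * r := by simp
    rw [h2, hei] at h1
    linarith
  · rw [dist_self_add_right, PiLp.norm_single, Real.norm_eq_abs, abs_mul, he, one_mul,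
      abs_of_pos hr]

/-- Truncation is harmless: if `c` is cut off, some point outside the cube lies at distance `r` from
`c`, and there `J` vanishes, so `J t` is small by uniform continuity. -/
theorem norm_indicator_innerCube_sub_le {J : Space → Space} (hJ0 : ∀ t, t ∉ cube → J t = 0)
    {η δ r d : ℝ} (hJ : ∀ {s t}, dist s t < δ → dist (J s) (J t) < η) (hr : 0 < r)
    (hd : d + r < δ) {c t : Space} (hct : dist c t ≤ d) :
    ‖(innerCube r).indicator J c - J t‖ ≤ η := by
  by_cases hc : c ∈ innerCube r
  · rw [Set.indicator_of_mem hc, ← dist_eq_norm]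
    exact (hJ (by linarith)).le
  · rw [Set.indicator_of_notMem hc, zero_sub, norm_neg]
    obtain ⟨c', hc', h4⟩ := exists_dist_eq_of_notMem_innerCube hr hc
    have h5 := dist_triangle t c c'
    rw [dist_comm t c, h4] at h5
    have h6 : dist (J t) (J c') < η := hJ (by linarith)
    rw [hJ0 _ hc', dist_zero_right] at h6
    exact h6.le

/-- The convolution of the rescaled profile with a truncated field is a limit of currents. -/
theorem exists_isCurrentLimit_eq_integral (hγ : 0 < γ) (hξ : IsCurrentProfile ξ) {r : ℝ}
    (hr : 0 < r) {J : Space → Space} (hJ : Continuous J) (hJ0 : ∀ t, t ∉ cube → J t = 0) :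
    IsCurrentLimit γ ξ
      (fun t => ∫ c, scaled ξ r (t - c) • (innerCube r).indicator J c) ∧
    ∀ t, Integrable fun c => scaled ξ r (t - c) • (innerCube r).indicator J c := by
  obtain ⟨F, hFc, hF⟩ := exists_continuous_kernel hξ hr hJ hJ0
  have hball : innerCube r ⊆ Metric.closedBall 0 1 := fun c hc =>
    cube_subset_closedBall fun i => abs_le.1 <| (hc i).trans (by linarith)
  obtain ⟨G, hG⟩ : ∃ G : Space → Space →ᵇ Space, G = (innerCube r).indicator F := ⟨_, rfl⟩
  -- Integrating over a ball instead of `innerCube r` guarantees positive volume, as the inner cube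
  -- may be null or empty for large `r`.
  have hint : IntegrableOn G (Metric.closedBall 0 1) := by
    rw [hG]
    exact (hFc.continuousOn.integrableOn_compact (isCompact_closedBall 0 1)).indicator
      (measurableSet_innerCube r)
  have hGt : ∀ c t, G c t = scaled ξ r (t - c) • (innerCube r).indicator J c := by
    intro c t
    by_cases hc : c ∈ innerCube r
    · rw [hG, Set.indicator_of_mem hc, Set.indicator_of_mem hc, hF]
    · rw [hG, Set.indicator_of_notMem hc, Set.indicator_of_notMem hc, smul_zero,
        BoundedContinuousFunction.coe_zero, Pi.zero_apply]
  have hlim : ∀ c, IsCurrentLimit γ ξ (G c) := by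
    intro c
    rw [show (G c : Space → Space) = fun t => scaled ξ r (t - c) • (innerCube r).indicator J c
      from funext (hGt c)]
    by_cases hc : c ∈ innerCube r
    · exact isCurrentLimit_scaled_smul hγ hξ hr hc _
    -- Here the kernel is zero, obtained as a current limit from an arbitrary admissible centre with
    -- zero direction.
    · simpa only [Set.indicator_of_notMem hc, smul_zero] using isCurrentLimit_scaled_smul hγ hξ
        (r := 1 / 2) (by norm_num) (c := 0) (fun i => by simp) 0
  have hzero : ∀ t, ∀ c ∉ Metric.closedBall (0 : Space) 1,
      scaled ξ r (t - c) • (innerCube r).indicator J c = 0 := fun t c hc => by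
    rw [Set.indicator_of_notMem fun h => hc (hball h), smul_zero]
  have heval : ∀ t, IntegrableOn (fun c => scaled ξ r (t - c) • (innerCube r).indicator J c)
      (Metric.closedBall 0 1) ∧ (∫ c in Metric.closedBall 0 1, G c : Space →ᵇ Space) t =
        ∫ c, scaled ξ r (t - c) • (innerCube r).indicator J c := by
    intro t
    have h1 := (BoundedContinuousFunction.evalCLM ℝ t :
      (Space →ᵇ Space) →L[ℝ] Space).integrable_comp hint
    have h2 := (BoundedContinuousFunction.evalCLM ℝ t :
      (Space →ᵇ Space) →L[ℝ] Space).integral_comp_comm hint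
    simp only [BoundedContinuousFunction.evalCLM_apply, hGt] at h1 h2
    exact ⟨h1, by rw [← h2, setIntegral_eq_integral_of_forall_compl_eq_zero (hzero t)]⟩
  refine ⟨?_, fun t => (integrableOn_iff_integrable_of_support_subset fun c hc => by
    by_contra h
    exact hc (hzero t c h)).1 (heval t).1⟩
  rw [← funext fun t => (heval t).2]
  exact isCurrentLimit_setIntegral (Metric.measure_closedBall_pos volume 0 one_pos).ne'
    measure_closedBall_lt_top.ne hlim hint

theorem isCurrentLimit_of_continuous (hγ : 0 < γ) (hξ : IsCurrentProfile ξ) {J : Space → Space}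
    (hJ : Continuous J) (hJ0 : ∀ t, t ∉ cube → J t = 0) : IsCurrentLimit γ ξ J := by
  refine isCurrentLimit_of_forall fun η hη => ?_
  obtain ⟨R, hR, hξ0⟩ := hξ.exists_eq_zero
  have hJsupp : HasCompactSupport J := HasCompactSupport.intro isCompact_cube fun t ht => hJ0 t ht
  obtain ⟨δ, hδ, hJδ⟩ := Metric.uniformContinuous_iff.1
    (hJsupp.uniformContinuous_of_continuous hJ) η hη
  -- Chosen so that the kernel radius `r R` plus the truncation width `r` equals `δ / 2`.
  set r : ℝ := δ / (2 * (R + 1)) with hrdef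
  have hr : 0 < r := by positivity
  have hrδ : r * R + r < δ := by
    have : r * R + r = δ / 2 := by
      rw [hrdef]
      field_simp
    linarith
  obtain ⟨hlim, hint⟩ := exists_isCurrentLimit_eq_integral hγ hξ hr hJ hJ0
  exact ⟨_, hlim, fun t => norm_integral_scaled_smul_sub_le hξ hξ0 hr (hint t) fun c hct =>
    norm_indicator_innerCube_sub_le hJ0 (fun h => hJδ h) hr hrδ hct⟩

end Approximation

/-! ### The main theorem -/

/-- If every tolerance can be met eventually, then a single sequence meets all of them. -/
theorem exists_seq_of_eventually {α : ℕ → Type*} [∀ l, Nonempty (α l)]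
    (P : (l : ℕ) → ℝ → α l → Prop) (hmono : ∀ l η η' x, η ≤ η' → P l η x → P l η' x)
    (h : ∀ η, 0 < η → ∀ᶠ l in atTop, ∃ x, P l η x) :
    ∃ x : (l : ℕ) → α l, ∀ η, 0 < η → ∀ᶠ l in atTop, P l η (x l) := by
  classical
  -- At index `l`, aim for the best tolerance `1 / (k + 1)` with `k ≤ l` that can be met; `k l`
  -- eventually exceeds every `n`.
  let k : ℕ → ℕ := fun l => Nat.findGreatest (fun k => ∃ x : α l, P l (1 / ((k : ℝ) + 1)) x) l
  have hx : ∀ l, ∃ x : α l, (∃ y : α l, P l (1 / ((k l : ℝ) + 1)) y) →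
      P l (1 / ((k l : ℝ) + 1)) x := fun l => by
    by_cases hy : ∃ y : α l, P l (1 / ((k l : ℝ) + 1)) y
    · obtain ⟨y, hy⟩ := hy
      exact ⟨y, fun _ => hy⟩
    · exact ⟨Classical.arbitrary _, fun h => absurd h hy⟩
  choose x hx using hx
  refine ⟨x, fun η hη => ?_⟩
  obtain ⟨n, hn⟩ := exists_nat_one_div_lt hη
  filter_upwards [h _ (Nat.one_div_pos_of_nat (n := n)), eventually_ge_atTop n] with l hl hnl
  have h1 : n ≤ k l := Nat.le_findGreatest hnl hl
  have h2 : ∃ y : α l, P l (1 / ((k l : ℝ) + 1)) y :=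
    Nat.findGreatest_spec (P := fun k => ∃ x : α l, P l (1 / ((k : ℝ) + 1)) x) hnl hl
  exact hmono l _ _ _ ((Nat.one_div_le_one_div h1).trans hn.le) (hx l h2)

instance (l : ℕ) : Nonempty (State l) :=
  ⟨(exists_state_current (l := l) ∅ ∅ (Finset.disjoint_empty_left _)).choose⟩

theorem rescaledCurrentDensity_eq_zero {γ : ℝ} (ξ : Space → ℝ) {l : ℕ} {ρ : State l}
    (h : ∀ x y : box l, ρ.expect (currentObservable γ x y) = 0) (t : Space) :
    rescaledCurrentDensity γ ξ ρ t = 0 := by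
  simp [rescaledCurrentDensity, currentDensity, h]

/-- Mix a current-free almost minimizer with a small fraction `ε = w / D²` of a current-carrying
state. The current is then exactly `ε` times that of the second state, and convexity controls the
free energy. -/
theorem eventually_exists_state (μ lam : ℝ) {γ β : ℝ} (ϑ : ℝ) (hβ : 0 < β)
    {ξ : Space → ℝ} {B : Space → Space} (hB : MemLp B 2 (volume.restrict cube))
    {J : Space → Space} (hJ : IsCurrentLimit γ ξ J) {η : ℝ} (hη : 0 < η) :
    ∀ᶠ l : ℕ in atTop, ∃ ρ : State l,
      |freeEnergyDensity μ lam γ ϑ β B ρ -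
        ⨅ σ : State l, freeEnergyDensity μ lam γ ϑ β B σ| ≤ η ∧
      ∀ t, ‖rescaledCurrentDensity γ ξ ρ t - J t‖ ≤ η := by
  obtain ⟨C, hC⟩ := hJ η hη
  obtain ⟨K, hK, hbound⟩ := exists_abs_freeEnergyDensity_le μ lam γ ϑ hβ hB
  have hD : Tendsto (fun l : ℕ => 2 * (l : ℝ)) atTop atTop :=
    tendsto_natCast_atTop_atTop.const_mul_atTop (by norm_num)
  have hlim1 : ∀ᶠ l : ℕ in atTop, |C| / (2 * (l : ℝ)) ^ 2 ≤ 1 :=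
    (((tendsto_pow_atTop (two_ne_zero)).comp hD).const_div_atTop |C|).eventually_le_const one_pos
  have hlim2 : ∀ᶠ l : ℕ in atTop, 2 * |C| * K / √(2 * (l : ℝ)) ≤ η / 2 :=
    ((Real.tendsto_sqrt_atTop.comp hD).const_div_atTop (2 * |C| * K)).eventually_le_const
      (by positivity)
  filter_upwards [hC, hlim1, hlim2, eventually_gt_atTop 0] with l h1 h2 h3 hl
  obtain ⟨w, hw0, hw, σ, hσ⟩ := h1
  set D : ℝ := 2 * (l : ℝ) with hDdef
  have hDpos : 0 < D := by positivity
  have hbdd := bddBelow_freeEnergyDensity μ lam γ ϑ hβ B l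
  set f : State l → ℝ := fun σ => freeEnergyDensity μ lam γ ϑ β B σ with hf
  obtain ⟨ρ₀, hρ₀⟩ := exists_lt_of_ciInf_lt
    (show ⨅ σ, f σ < (⨅ σ, f σ) + η / 2 by linarith)
  obtain ⟨ρ₁, hρ₁, hcur⟩ := exists_freeEnergyDensity_le_currentFree μ lam γ ϑ hβ B ρ₀
  set ε : ℝ := w / D ^ 2 with hε
  have hε0 : 0 ≤ ε := by positivity
  have hεC : ε ≤ |C| / D ^ 2 :=
    div_le_div_of_nonneg_right (hw.trans (le_abs_self C)) (by positivity)
  have hε1 : ε ≤ 1 := hεC.trans h2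
  refine ⟨ρ₁.mix σ (1 - ε) ε (by linarith) hε0 (by ring), ?_, fun t => ?_⟩
  · have h4 := freeEnergyDensity_mix_le ρ₁ σ (p := 1 - ε) (q := ε) (by linarith) hε0 (by ring)
      μ lam γ ϑ hβ B
    have h5 := ciInf_le hbdd (ρ₁.mix σ (1 - ε) ε (by linarith) hε0 (by ring))
    have h6 := (abs_le.1 (hbound l hl ρ₁)).1
    have h7 := (abs_le.1 (hbound l hl σ)).2
    -- The product of `D⁻²` and `D^(3/2)` is `D^(-1/2)`, which tends to zero.
    have h8 : ε * (2 * (K * (D * √D))) ≤ η / 2 := by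
      refine le_trans ?_ h3
      refine (mul_le_mul_of_nonneg_right hεC (by positivity)).trans_eq ?_
      have hs : √D * √D = D := Real.mul_self_sqrt hDpos.le
      have hs0 : 0 < √D := Real.sqrt_pos.2 hDpos
      rw [div_mul_eq_mul_div, div_eq_div_iff (by positivity) hs0.ne']
      linear_combination (2 * |C| * K * D) * hs
    have h9 : ε * (freeEnergyDensity μ lam γ ϑ β B σ - freeEnergyDensity μ lam γ ϑ β B ρ₁) ≤
        ε * (2 * (K * (D * √D))) := mul_le_mul_of_nonneg_left (by linarith) hε0
    rw [abs_of_nonneg (sub_nonneg.2 h5)]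
    simp only [hf] at hρ₀
    linarith
  · rw [rescaledCurrentDensity_mix, rescaledCurrentDensity_eq_zero ξ hcur, smul_zero, zero_add]
    exact hσ t

end BCSHubbard

theorem mainTheorem3
    (μ lam γ ϑ β : ℝ) (hγ : 0 < γ) (hϑ : 0 < ϑ) (hβ : 0 < β)
    (ξ : BCSHubbard.Space → ℝ) (hξ : BCSHubbard.IsCurrentProfile ξ)
    (B : BCSHubbard.Space → BCSHubbard.Space)
    (hB : MemLp B 2 (volume.restrict BCSHubbard.cube))
    (j : BCSHubbard.Space → BCSHubbard.Space)
    (hj : ContDiffOn ℝ ∞ j BCSHubbard.cube)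
    (hj0 : ∀ t ∈ frontier BCSHubbard.cube, j t = 0) :
    (∀ l : ℕ, BddBelow (Set.range fun σ : BCSHubbard.State l =>
        BCSHubbard.freeEnergyDensity μ lam γ ϑ β B σ)) ∧
    ∃ ρ : (l : ℕ) → BCSHubbard.State l,
      Tendsto (fun l : ℕ =>
          |BCSHubbard.freeEnergyDensity μ lam γ ϑ β B (ρ l) -
            ⨅ σ : BCSHubbard.State l, BCSHubbard.freeEnergyDensity μ lam γ ϑ β B σ|)
        atTop (𝓝 0) ∧
      TendstoUniformly
        (fun (l : ℕ) (t : BCSHubbard.Space) => BCSHubbard.rescaledCurrentDensity γ ξ (ρ l) t)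
        (BCSHubbard.cube.indicator j) atTop := by
  refine ⟨BCSHubbard.bddBelow_freeEnergyDensity μ lam γ ϑ hβ B, ?_⟩
  -- Extension by zero is continuous because `j` vanishes on the frontier; only continuity of `j` on
  -- the cube enters from here on.
  have hJ : Continuous (BCSHubbard.cube.indicator j) := by
    refine continuous_indicator hj0 ?_
    rw [BCSHubbard.isClosed_cube.closure_eq]
    exact hj.continuousOn
  have hlim := BCSHubbard.isCurrentLimit_of_continuous hγ hξ hJ fun t ht =>
    Set.indicator_of_notMem ht j
  obtain ⟨ρ, hρ⟩ := BCSHubbard.exists_seq_of_eventually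
    (fun l η (ρ : BCSHubbard.State l) =>
      |BCSHubbard.freeEnergyDensity μ lam γ ϑ β B ρ -
        ⨅ σ : BCSHubbard.State l, BCSHubbard.freeEnergyDensity μ lam γ ϑ β B σ| ≤ η ∧
      ∀ t, ‖BCSHubbard.rescaledCurrentDensity γ ξ ρ t - BCSHubbard.cube.indicator j t‖ ≤ η)
    (fun l η η' x h hx => ⟨hx.1.trans h, fun t => (hx.2 t).trans h⟩)
    (fun η hη => BCSHubbard.eventually_exists_state μ lam ϑ hβ hB hlim hη)
  refine ⟨ρ, ?_, ?_⟩
  · rw [Metric.tendsto_nhds]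
    intro ε hε
    filter_upwards [hρ (ε / 2) (by positivity)] with l hl
    rw [Real.dist_eq, sub_zero, abs_abs]
    linarith [hl.1]
  · rw [Metric.tendstoUniformly_iff]
    intro ε hε
    filter_upwards [hρ (ε / 2) (by positivity)] with l hl t
    rw [dist_comm, dist_eq_norm]
    linarith [hl.2 t]
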